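/- Theorem. Let $a_0,\dots,a_5\in\mathbb{C}$ be pairwise distinct and let $X\subset\mathbb{P}^5=\mathbb{P}^5_{\mathbb{C}}$ be the Kummer surface defined by $$\sum_{i=0}^5 x_i^2=\sum_{i=0}^5 a_ix_i^2=\sum_{i=0}^5 a_i^2x_i^2=0 ,$$ and let $\mathcal{N}$ be the net of quadrics spanned by these three. "General point of $X$" means every point of a Zariski open, Zariski dense subset of the (nonempty) set $X$. For a smooth point $x\in X$, let $\phi(t_1,t_2)$ be a lift to $\mathbb{C}^6$ of a local analytic parametrization of $X$ with $x=[\phi(0)]$. The embedded tangent plane $\mathbb{T}_xX$ and the second osculating space $\mathbb{T}^{(2)}_xX$ are the projectivizations of the spans $\hat{\mathbb T}_xX$ and $\hat{\mathbb T}^{(2)}_xX$ of all partial derivatives of $\phi$ at $0$ of order $\le 1$, respectively $\le 2$. The second fundamental form is $II_x(u,v)=\partial_u\partial_v\phi(0)\bmod \hat{\mathbb{T}}_xX$, with values in $\mathbb{C}^6/\hat{\mathbb{T}}_xX$. For a hyperplane $H=\{h=0\}$ containing $\mathbb{T}_xX$, the zero locus of the quadratic form $u\mapsto h(II_x(u,u))$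 is the tangent cone at $x$ of the section $H\cap X$ (when this form is not zero); $|II_x|$ is the linear system of these quadratic forms on $T_xX$. Then: 1. $X$ is a $\Phi$ surface: at a general point $x\in X$, $X$ is smooth of dimension $2$, $\dim \mathbb{T}^{(2)}_xX=4$, and $|II_x|$ is a pencil ($\dim|II_x|=1$). 2. $X$ is not covered by lines; indeed no line through a general point of $X$ is contained in $X$. 3. At a general point $y\in X$ there is exactly one involution (projectivity of order two) $\sigma$ of the pencil of lines through $y$ in $\mathbb{T}_yX$ such that both of the following hold: the intersections $Q\cap\mathbb{T}_yX$, where $Q$ runs over the quadrics of $\mathcal{N}$ not containing $\mathbb{T}_yX$, are exactly the pairs $\ell\cup\sigma(\ell)$; and the tangent cones at $y$, viewed in $\mathbb{T}_yX$, of the sections of $X$ by tangent hyperplanes having $y$ as a double point are exactly the pairs $\ell\cup\sigma(\ell)$. That is, the involution cut out by the quadrics of the net coincides with the involution defined by the second fundamental form. -/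

import Mathlib

open scoped LinearAlgebra.Projectivization Topology

noncomputable section

/-- The vector space `ℂ^(N+1)` of which `ℙ^N` is the projectivization. -/
abbrev HomCoord (N : ℕ) : Type := Fin (N + 1) → ℂ

/-- Complex projective space `ℙ^N`, as the set of its points. -/
abbrev ProjSpace (N : ℕ) : Type := ℙ ℂ (HomCoord N)

/-! ### General points -/

/-- Zariski closed subsets of `ℙ^N`: common zero loci of homogeneous polynomials. -/
def IsZariskiClosed {N : ℕ} (Z : Set (ProjSpace N)) : Prop :=
  ∃ S : Set (MvPolynomial (Fin (N + 1)) ℂ), (∀ F ∈ S, ∃ d : ℕ, F.IsHomogeneous d) ∧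
    Z = {x | ∀ F ∈ S, MvPolynomial.eval x.rep F = 0}

/-- `P` holds at a general point of the nonempty set `X`: it holds at every point of some
Zariski open and Zariski dense subset `X \ Z` of `X`. -/
def HoldsAtGeneralPoint {N : ℕ} (X : Set (ProjSpace N)) (P : ProjSpace N → Prop) : Prop :=
  X.Nonempty ∧ ∃ Z : Set (ProjSpace N), IsZariskiClosed Z ∧
    (∀ W : Set (ProjSpace N), IsZariskiClosed W → X \ Z ⊆ W → X ⊆ W) ∧
    ∀ x ∈ X \ Z, P x

/-! ### Lines -/

/-- The point `x` lies on a projective line contained in `X`. A projective line is given by a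
vector subspace `L` of dimension two. -/
def LiesOnLineIn {N : ℕ} (X : Set (ProjSpace N)) (x : ProjSpace N) : Prop :=
  ∃ L : Submodule ℂ (HomCoord N), Module.finrank ℂ L = 2 ∧ x.submodule ≤ L ∧
    ∀ z : ProjSpace N, z.submodule ≤ L → z ∈ X

/-- `X` is covered by lines: through a general point of `X` there passes a line contained
in `X`. -/
def IsCoveredByLines {N : ℕ} (X : Set (ProjSpace N)) : Prop :=
  HoldsAtGeneralPoint X (LiesOnLineIn X)

/-! ### Local parametrizations, osculating spaces, second fundamental form -/

/-- The affine cone over `X`, without the origin. -/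
def puncturedCone {N : ℕ} (X : Set (ProjSpace N)) : Set (HomCoord N) :=
  {v | ∃ hv : v ≠ 0, Projectivization.mk ℂ v hv ∈ X}

/-- `φ` is a lift to homogeneous coordinates of a local analytic parametrization, by two
parameters, of the surface `X` near its (smooth) point `x`, with `x = [φ 0]`: it is analytic,
`[φ]` is immersive at `0`, and the points `s • φ t`, with `s` near `1` and `t` near `0`,
fill exactly a neighbourhood of `φ 0` in the cone over `X`. -/
structure IsLocalParametrization {N : ℕ} (X : Set (ProjSpace N)) (x : ProjSpace N)
    (φ : (Fin 2 → ℂ) → HomCoord N) : Prop where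
  analyticAt : AnalyticAt ℂ φ 0
  base : φ 0 ∈ x.submodule
  immersive : LinearIndependent ℂ
    ![φ 0, fderiv ℂ φ 0 (Pi.single 0 1), fderiv ℂ φ 0 (Pi.single 1 1)]
  map_nhds : Filter.map (fun p : ℂ × (Fin 2 → ℂ) => p.1 • φ p.2) (𝓝 (1, 0)) =
    𝓝[puncturedCone X] (φ 0)

/-- `X` has a local parametrization at `x` (so that `x` is a smooth point of `X`, and `X` is a
surface near `x`), and every local parametrization of `X` at `x` satisfies `P`. -/
def HoldsInLocalParametrizations {N : ℕ} (X : Set (ProjSpace N)) (x : ProjSpace N)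
    (P : ((Fin 2 → ℂ) → HomCoord N) → Prop) : Prop :=
  (∃ φ, IsLocalParametrization X x φ) ∧ ∀ φ, IsLocalParametrization X x φ → P φ

/-- The cone in `ℂ^(N+1)` over the embedded `s`-th osculating space at `[φ 0]`: the span of
`φ 0` and of all derivatives of `φ` of order `≤ s` at `0`. Its dimension as a vector space
exceeds by one the dimension of the osculating space as a projective space. -/
def osculatingCone {N : ℕ} (φ : (Fin 2 → ℂ) → HomCoord N) (s : ℕ) :
    Submodule ℂ (HomCoord N) :=
  Submodule.span ℂ {w | ∃ k ≤ s, ∃ m : Fin k → (Fin 2 → ℂ), w = iteratedFDeriv ℂ k φ 0 m}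

/-- The cone over the embedded tangent plane. -/
abbrev tangentPlaneCone {N : ℕ} (φ : (Fin 2 → ℂ) → HomCoord N) : Submodule ℂ (HomCoord N) :=
  osculatingCone φ 1

/-- The projective second fundamental form at `[φ 0]`, with values in the normal space: the
tangent vectors `dφ u`, `dφ v` are sent to the class of `∂_u ∂_v φ (0)` modulo the cone over the
embedded tangent plane. (It is the derivative along `u` of the moving tangent plane, applied
to its section `∂_v φ`.) -/
def secondFundamentalForm {N : ℕ} (φ : (Fin 2 → ℂ) → HomCoord N) :
    (Fin 2 → ℂ) →ₗ[ℂ] (Fin 2 → ℂ) →ₗ[ℂ] (HomCoord N ⧸ tangentPlaneCone φ) :=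
  LinearMap.mk₂ ℂ
    (fun u v => (tangentPlaneCone φ).mkQ (fderiv ℂ (fderiv ℂ φ) 0 u v))
    (by intros; simp) (by intros; simp) (by intros; simp) (by intros; simp)

/-- The dual of the second fundamental form: a linear form `h` on the normal space, that is, an
equation of a tangent hyperplane `H`, is sent to the quadratic form `u ↦ h (II (u, u))` on the
tangent space, which is the equation of the tangent cone of the section of `X` by `H`. -/
def dualSecondFundamentalForm {N : ℕ} (φ : (Fin 2 → ℂ) → HomCoord N) :
    Module.Dual ℂ (HomCoord N ⧸ tangentPlaneCone φ) →ₗ[ℂ] QuadraticForm ℂ (Fin 2 → ℂ) where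
  toFun h := LinearMap.BilinMap.toQuadraticMap ((secondFundamentalForm φ).compr₂ h)
  map_add' h h' := by ext u; simp
  map_smul' c h := by ext u; simp

/-- The linear system `|II|` of quadrics in the projectivized tangent space, as a vector space
of quadratic forms. Its dimension as a vector space exceeds by one its projective dimension. -/
def secondFundamentalSystem {N : ℕ} (φ : (Fin 2 → ℂ) → HomCoord N) :
    Submodule ℂ (QuadraticForm ℂ (Fin 2 → ℂ)) :=
  LinearMap.range (dualSecondFundamentalForm φ)

/-- `X ⊂ ℙ^N`, `N ≥ 5`, is a `Φ` surface: at a general point `x` the embedded second osculating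
space has projective dimension `4`, and `|II_x|` is a pencil. -/
def IsPhiSurface {N : ℕ} (X : Set (ProjSpace N)) : Prop :=
  5 ≤ N ∧ HoldsAtGeneralPoint X fun x => HoldsInLocalParametrizations X x fun φ =>
    Module.finrank ℂ (osculatingCone φ 2) = 4 + 1 ∧
    Module.finrank ℂ (secondFundamentalSystem φ) = 1 + 1

/-! ### Involutions in the pencil of tangent lines -/

/-- The pencil of lines through the point `x` in the plane with cone `T`. -/
def LinePencil {N : ℕ} (x : ProjSpace N) (T : Submodule ℂ (HomCoord N)) : Type :=
  {L : Submodule ℂ (HomCoord N) // x.submodule ≤ L ∧ L ≤ T ∧ Module.finrank ℂ L = 2}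

/-- An involution of the pencil of lines: a projectivity, different from the identity, that is
its own inverse. -/
def IsInvolution {N : ℕ} {x : ProjSpace N} {T : Submodule ℂ (HomCoord N)}
    (σ : LinePencil x T → LinePencil x T) : Prop :=
  (∃ g : HomCoord N →ₗ[ℂ] HomCoord N, ∀ L, (σ L).1 = L.1.map g) ∧
    σ ≠ id ∧ ∀ L, σ (σ L) = L

/-- The pairs of lines `L ∪ σ L` of an involution, each seen as a subset of `ℂ^(N+1)`. -/
def involutionPairs {N : ℕ} {x : ProjSpace N} {T : Submodule ℂ (HomCoord N)}
    (σ : LinePencil x T → LinePencil x T) : Set (Set (HomCoord N)) :=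
  Set.range fun L => (L.1 : Set (HomCoord N)) ∪ (σ L).1

/-- The sections with the plane `T` of those quadrics of a linear system `𝒩` that do not
contain `T`. -/
def planeSections {N : ℕ} (𝒩 : Submodule ℂ (QuadraticForm ℂ (HomCoord N)))
    (T : Submodule ℂ (HomCoord N)) : Set (Set (HomCoord N)) :=
  {C | ∃ Q ∈ 𝒩, (∃ w ∈ T, Q w ≠ 0) ∧ C = {w | w ∈ T ∧ Q w = 0}}

/-- The tangent cones at `[φ 0]`, inside the embedded tangent plane, of the tangent hyperplane
sections for which this point is a double point (that is, of those with nonzero quadratic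
part). -/
def hyperplaneSectionTangentCones {N : ℕ} (φ : (Fin 2 → ℂ) → HomCoord N) :
    Set (Set (HomCoord N)) :=
  {C | ∃ q ∈ secondFundamentalSystem φ, q ≠ 0 ∧
    C = {w | ∃ (c : ℂ) (u : Fin 2 → ℂ), q u = 0 ∧ w = c • φ 0 + fderiv ℂ φ 0 u}}

/-! ### The Kummer surface -/

/-- The quadratic forms `∑ a_i^k x_i^2`, `k = 0, 1, 2`. -/
def kummerQuadric (a : Fin 6 → ℂ) (k : Fin 3) : QuadraticForm ℂ (HomCoord 5) :=
  QuadraticMap.weightedSumSquares ℂ fun i => a i ^ (k : ℕ)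

/-- The net of quadrics spanned by the three quadrics. -/
def kummerNet (a : Fin 6 → ℂ) : Submodule ℂ (QuadraticForm ℂ (HomCoord 5)) :=
  Submodule.span ℂ (Set.range (kummerQuadric a))

/-- The Kummer surface `∑ x_i^2 = ∑ a_i x_i^2 = ∑ a_i^2 x_i^2 = 0` in `ℙ^5`. -/
def kummerSurface (a : Fin 6 → ℂ) : Set (ProjSpace 5) :=
  {x | ∀ k : Fin 3, kummerQuadric a k x.rep = 0}

end

noncomputable section

/-! For `x` on the cone over the surface, off the coordinate hyperplanes, consider f(t) = ∑
x_i^2/(a_i - t). Over the common denominator its numerator is a quadratic polynomial, because the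
moments of `x_i^2` of order 0, 1, 2 vanish. In general it has two distinct zeros `b`, `c`, and these
give the polar vectors with coordinates x_i/(a_i - b) and x_i/(a_i - c). Partial fractions show that
`x` and the two polar vectors are pairwise orthogonal for all three quadrics, that `x` is isotropic,
and that the k-th quadric takes the values A b^k and B c^k on the polar vectors (`sum_left`,
`sum_mixed`, `sum_sq`). Here A = f'(b) and B = f'(c) are nonzero since the zeros are simple
(`sum_sq_ne_zero`).

Thus `x` and the polar vectors form a basis of the cone over the tangent plane, and in the
coordinates X, Y along the polar vectors the k-th quadric restricts to A b^k X^2 + B c^k Y^2. As b ≠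
c, the net cuts out exactly the conics α X^2 + β Y^2 = 0. Differentiating the equations twice along
a parametrization shows that the differential of the k-th equation sends a second derivative to
minus the polar form of the same restriction. Hence |II| is spanned by X^2 and Y^2: it is a pencil,
the second osculating space gains two dimensions over the tangent plane, and both families of line
pairs belong to the involution Y ↦ -Y. A line in the surface through the point would lie in the
tangent plane and satisfy X^2 = Y^2 = 0, which leaves only the point.

Two existence questions remain. A local parametrization is explicit because the equations are linear
in the squares of the coordinates. For the density of general points, a vector of squares is moved
along a suitable solution of the same linear equations, and nearby square roots are extracted; this
gives density in the classical topology, hence in the Zariski topology. -/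

/-- The linear form on `ℂ^6` with given coefficients. -/
def coordForm (d : Fin 6 → ℂ) : HomCoord 5 →ₗ[ℂ] ℂ where
  toFun w := ∑ i, d i * w i
  map_add' v w := by simp [mul_add, Finset.sum_add_distrib]
  map_smul' c w := by simp [Finset.mul_sum, mul_left_comm]

lemma coordForm_apply (d w : Fin 6 → ℂ) : coordForm d w = ∑ i, d i * w i := rfl

/-- The differentials at `x` of the three quadrics, up to the factor two. -/
def jacobianMap (a x : Fin 6 → ℂ) : HomCoord 5 →ₗ[ℂ] (Fin 3 → ℂ) :=
  LinearMap.pi fun k => coordForm fun i => a i ^ (k : ℕ) * x i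

lemma jacobianMap_apply (a x w : Fin 6 → ℂ) (k : Fin 3) :
    jacobianMap a x w k = ∑ i, a i ^ (k : ℕ) * x i * w i := rfl

/-- The vector with coordinates `x_i / (a_i - b)`. -/
def polarVec (a x : Fin 6 → ℂ) (b : ℂ) : HomCoord 5 := fun i => x i / (a i - b)

/-- `x` lies on the cone over the Kummer surface, off the coordinate hyperplanes, and the rational
function `∑ x_i^2 / (a_i - t)` has the two distinct zeros `b` and `c`. -/
structure IsPolarPair (a x : Fin 6 → ℂ) (b c : ℂ) : Prop where
  coord_ne : ∀ i, x i ≠ 0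
  moment : ∀ k : Fin 3, ∑ i, a i ^ (k : ℕ) * x i ^ 2 = 0
  ne : b ≠ c
  left_ne : ∀ i, a i - b ≠ 0
  right_ne : ∀ i, a i - c ≠ 0
  left_zero : ∑ i, x i ^ 2 / (a i - b) = 0
  right_zero : ∑ i, x i ^ 2 / (a i - c) = 0

/-! ### Orthogonality of the polar vectors with respect to the net -/

namespace IsPolarPair

variable {a x : Fin 6 → ℂ} {b c : ℂ}

lemma symm (h : IsPolarPair a x b c) : IsPolarPair a x c b :=
  ⟨h.coord_ne, h.moment, h.ne.symm, h.right_ne, h.left_ne, h.right_zero, h.left_zero⟩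

/-- Division with remainder: a^k/(a - b) is b^k/(a - b) plus a polynomial in a of degree k - 1 ≤ 1,
so only f(b) and the moments of order 0 and 1 enter. -/
lemma sum_left (h : IsPolarPair a x b c) (k : Fin 3) :
    ∑ i, a i ^ (k : ℕ) * x i * polarVec a x b i = 0 := by
  have h0 := h.moment 0
  have h1 := h.moment 1
  have hl := h.left_zero
  have key : ∑ i, a i ^ (k : ℕ) * x i * polarVec a x b i =
      b ^ (k : ℕ) * ∑ i, x i ^ 2 / (a i - b) +
      (if k = 0 then 0 else if k = 1 then 1 else b) * ∑ i, a i ^ ((0 : Fin 3) : ℕ) * x i ^ 2 +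
      (if k = 2 then 1 else 0) * ∑ i, a i ^ ((1 : Fin 3) : ℕ) * x i ^ 2 := by
    simp only [Finset.mul_sum, ← Finset.sum_add_distrib]
    refine Finset.sum_congr rfl fun i _ => ?_
    have := h.left_ne i
    fin_cases k <;> simp [polarVec] <;> field_simp <;> ring
  rw [key, h0, h1, hl]; simp

/-- Partial fractions: 1/((a - b)(a - c)) is the difference of 1/(a - b) and 1/(a - c), divided by b
- c. -/
lemma sum_mixed (h : IsPolarPair a x b c) (k : Fin 3) :
    ∑ i, a i ^ (k : ℕ) * (polarVec a x b i * polarVec a x c i) = 0 := by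
  have hb := h.sum_left k
  have hc := h.symm.sum_left k
  have hne := sub_ne_zero.2 h.ne
  have key : ∑ i, a i ^ (k : ℕ) * (polarVec a x b i * polarVec a x c i) =
      (∑ i, a i ^ (k : ℕ) * x i * polarVec a x b i -
        ∑ i, a i ^ (k : ℕ) * x i * polarVec a x c i) / (b - c) := by
    rw [← Finset.sum_sub_distrib, Finset.sum_div]
    refine Finset.sum_congr rfl fun i _ => ?_
    have := h.left_ne i
    have := h.right_ne i
    simp only [polarVec]
    field_simp
    ring
  rw [key, hb, hc]; simp

/-- Expanding a^k in powers of a - b gives a^k/(a - b)^2 = b^k/(a - b)^2 + k b^(k-1)/(a - b), plus 1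
when k = 2. -/
lemma sum_sq (h : IsPolarPair a x b c) (k : Fin 3) :
    ∑ i, a i ^ (k : ℕ) * polarVec a x b i ^ 2 = b ^ (k : ℕ) * ∑ i, polarVec a x b i ^ 2 := by
  have h0 := h.moment 0
  have hl := h.left_zero
  have key : ∑ i, a i ^ (k : ℕ) * polarVec a x b i ^ 2 =
      b ^ (k : ℕ) * ∑ i, polarVec a x b i ^ 2 +
      (if k = 0 then 0 else if k = 1 then 1 else 2 * b) * ∑ i, x i ^ 2 / (a i - b) +
      (if k = 2 then 1 else 0) * ∑ i, a i ^ ((0 : Fin 3) : ℕ) * x i ^ 2 := by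
    simp only [Finset.mul_sum, ← Finset.sum_add_distrib]
    refine Finset.sum_congr rfl fun i _ => ?_
    have := h.left_ne i
    fin_cases k <;> simp [polarVec] <;> field_simp <;> ring
  rw [key, h0, hl]; simp

/-- The zero `b` is a simple one. -/
lemma sum_sq_ne_zero (h : IsPolarPair a x b c) (ha : Function.Injective a) :
    ∑ i, polarVec a x b i ^ 2 ≠ 0 := by
  intro hA
  have h0 : ∑ i, a i ^ 0 * x i ^ 2 = 0 := h.moment 0
  have h1 : ∑ i, a i ^ 1 * x i ^ 2 = 0 := h.moment 1
  have h2 : ∑ i, a i ^ 2 * x i ^ 2 = 0 := h.moment 2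
  have hl := h.left_zero
  have hr := h.right_zero
  have hne := sub_ne_zero.2 h.ne
  -- If b were a double zero, clearing the denominator (t - b)^2 (t - c) would turn f(b) = f'(b) =
  -- f(c) = 0 and the three moment equations into six linear conditions on `u`. Their test
  -- polynomials span all polynomials of degree at most 5, so all moments `s k` with k < 6 vanish,
  -- and the Vandermonde matrix of the distinct `a i` forces u = 0.
  set u : Fin 6 → ℂ := fun i => x i ^ 2 / ((a i - b) ^ 2 * (a i - c)) with hu
  have hS (d : Fin 6 → ℂ) : ∑ i, (d i * ((a i - b) ^ 2 * (a i - c))) * u i = ∑ i, d i * x i ^ 2 := by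
    refine Finset.sum_congr rfl fun i _ => ?_
    have := h.left_ne i
    have := h.right_ne i
    simp only [hu]
    field_simp
  have f1 : ∑ i, (a i - c) * u i = 0 := by
    refine Eq.trans ?_ hA
    refine Finset.sum_congr rfl fun i _ => ?_
    have := h.left_ne i
    have := h.right_ne i
    simp only [hu, polarVec]
    field_simp
  have f2 : ∑ i, ((a i - b) * (a i - c)) * u i = 0 := by
    refine Eq.trans ?_ hl
    refine Finset.sum_congr rfl fun i _ => ?_
    have := h.left_ne i
    have := h.right_ne i
    simp only [hu]
    field_simp
  have f3 : ∑ i, (a i - b) ^ 2 * u i = 0 := by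
    refine Eq.trans ?_ hr
    refine Finset.sum_congr rfl fun i _ => ?_
    have := h.left_ne i
    have := h.right_ne i
    simp only [hu]
    field_simp
  set s : ℕ → ℂ := fun k => ∑ i, u i * a i ^ k with hs
  have g1 : s 1 - c * s 0 = 0 := by
    refine Eq.trans ?_ f1
    simp only [hs, Finset.mul_sum, ← Finset.sum_sub_distrib]
    exact Finset.sum_congr rfl fun i _ => by ring
  have g2 : s 2 - (b + c) * s 1 + b * c * s 0 = 0 := by
    refine Eq.trans ?_ f2
    simp only [hs, Finset.mul_sum, ← Finset.sum_sub_distrib, ← Finset.sum_add_distrib]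
    exact Finset.sum_congr rfl fun i _ => by ring
  have g3 : s 2 - 2 * b * s 1 + b ^ 2 * s 0 = 0 := by
    refine Eq.trans ?_ f3
    simp only [hs, Finset.mul_sum, ← Finset.sum_sub_distrib, ← Finset.sum_add_distrib]
    exact Finset.sum_congr rfl fun i _ => by ring
  have k0 : s 0 = 0 := by
    have : (b - c) ^ 2 * s 0 = 0 := by linear_combination g3 - g2 + (b - c) * g1
    simpa [hne] using this
  have k1 : s 1 = 0 := by linear_combination g1 + c * k0
  have k2 : s 2 = 0 := by linear_combination g2 + (b + c) * k1 - b * c * k0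
  have g (n : ℕ) : s (n + 3) - (2 * b + c) * s (n + 2) + (b ^ 2 + 2 * b * c) * s (n + 1)
      - b ^ 2 * c * s n = ∑ i, (a i ^ n * ((a i - b) ^ 2 * (a i - c))) * u i := by
    simp only [hs, Finset.mul_sum, ← Finset.sum_sub_distrib, ← Finset.sum_add_distrib]
    exact Finset.sum_congr rfl fun i _ => by ring
  have k3 : s 3 = 0 := by
    have := (g 0).trans ((hS _).trans h0)
    linear_combination this + (2 * b + c) * k2 - (b ^ 2 + 2 * b * c) * k1 + b ^ 2 * c * k0
  have k4 : s 4 = 0 := by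
    have := (g 1).trans ((hS _).trans h1)
    linear_combination this + (2 * b + c) * k3 - (b ^ 2 + 2 * b * c) * k2 + b ^ 2 * c * k1
  have k5 : s 5 = 0 := by
    have := (g 2).trans ((hS _).trans h2)
    linear_combination this + (2 * b + c) * k4 - (b ^ 2 + 2 * b * c) * k3 + b ^ 2 * c * k2
  have hu0 : u = 0 := by
    have hk (k : ℕ) (hk : k < 6) : s k = 0 := by interval_cases k <;> assumption
    exact Matrix.eq_zero_of_forall_pow_sum_mul_pow_eq_zero ha fun k => hk k k.2
  have := congrFun hu0 0
  have hx := h.coord_ne 0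
  have hb := h.left_ne 0
  have hc := h.right_ne 0
  simp [hu, hx, hb, hc] at this

end IsPolarPair

/-! ### The polar basis of the tangent plane -/

namespace IsPolarPair

variable {a x : Fin 6 → ℂ} {b c : ℂ}

/-- The coefficient of `polarVec a x b` in a tangent vector. -/
def leftCoord (_ : IsPolarPair a x b c) : HomCoord 5 →ₗ[ℂ] ℂ :=
  (∑ i, polarVec a x b i ^ 2)⁻¹ • coordForm (polarVec a x b)

lemma leftCoord_self (h : IsPolarPair a x b c) : h.leftCoord x = 0 := by
  have := h.sum_left 0
  simp only [Fin.val_zero, pow_zero, one_mul] at this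
  simp only [leftCoord, LinearMap.smul_apply, coordForm_apply, mul_comm (polarVec _ _ _ _), this,
    smul_zero]

lemma leftCoord_left (h : IsPolarPair a x b c) (ha : Function.Injective a) :
    h.leftCoord (polarVec a x b) = 1 := by
  simp only [leftCoord, LinearMap.smul_apply, coordForm_apply, ← pow_two, smul_eq_mul]
  exact inv_mul_cancel₀ (h.sum_sq_ne_zero ha)

lemma leftCoord_right (h : IsPolarPair a x b c) : h.leftCoord (polarVec a x c) = 0 := by
  have := h.sum_mixed 0
  simp only [Fin.val_zero, pow_zero, one_mul] at this
  simp only [leftCoord, LinearMap.smul_apply, coordForm_apply, this, smul_zero]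

/-- The coefficient of `polarVec a x c` in a tangent vector. -/
def rightCoord (h : IsPolarPair a x b c) : HomCoord 5 →ₗ[ℂ] ℂ := h.symm.leftCoord

lemma rightCoord_self (h : IsPolarPair a x b c) : h.rightCoord x = 0 := h.symm.leftCoord_self

lemma rightCoord_left (h : IsPolarPair a x b c) : h.rightCoord (polarVec a x b) = 0 :=
  h.symm.leftCoord_right

lemma rightCoord_right (h : IsPolarPair a x b c) (ha : Function.Injective a) :
    h.rightCoord (polarVec a x c) = 1 := h.symm.leftCoord_left ha

lemma ne_zero (h : IsPolarPair a x b c) : x ≠ 0 := fun h0 => h.coord_ne 0 (congrFun h0 0)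

lemma linearIndependent (h : IsPolarPair a x b c) (ha : Function.Injective a) :
    LinearIndependent ℂ ![x, polarVec a x b, polarVec a x c] := by
  rw [Fintype.linearIndependent_iff]
  intro g hg
  simp only [Fin.sum_univ_three, Matrix.cons_val] at hg
  have h1 := congrArg h.leftCoord hg
  have h2 := congrArg h.rightCoord hg
  simp only [map_add, map_smul, h.leftCoord_self, h.leftCoord_left ha, h.leftCoord_right,
    h.rightCoord_self, h.rightCoord_left, h.rightCoord_right ha, smul_eq_mul, mul_zero, mul_one,
    zero_add, add_zero, map_zero] at h1 h2
  have h0 : g 0 = 0 := by simpa [h1, h2, h.ne_zero] using hg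
  intro i; fin_cases i <;> assumption

lemma jacobianMap_surjective (h : IsPolarPair a x b c) (ha : Function.Injective a) :
    LinearMap.range (jacobianMap a x) = ⊤ := by
  by_contra hne
  obtain ⟨f, hf, hle⟩ := (LinearMap.range (jacobianMap a x)).exists_le_ker_of_lt_top
    (lt_top_iff_ne_top.2 hne)
  apply hf
  -- A linear form vanishing on the range gives a polynomial of degree at most 2 with zeros at the
  -- nodes, since no `x i` is zero; three nodes suffice to make it zero.
  have hc : (fun k => f (Pi.single k 1)) = 0 := by
    refine Matrix.eq_zero_of_forall_index_sum_mul_pow_eq_zero (f := fun i => a (Fin.castLE (by norm_num) i))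
      (fun i j hij => by simpa using ha hij) fun j => ?_
    set i : Fin 6 := Fin.castLE (by norm_num) j
    have := hle ⟨Pi.single i 1, rfl⟩
    rw [LinearMap.mem_ker, LinearMap.pi_apply_eq_sum_univ f] at this
    simp only [jacobianMap_apply, smul_eq_mul, Pi.single_apply, mul_ite, mul_one, mul_zero,
      Finset.sum_ite_eq', Finset.mem_univ, if_true] at this
    have hx := h.coord_ne i
    have e : (∑ k : Fin 3, f (Pi.single k 1) * a i ^ (k : ℕ)) * x i = 0 := by
      rw [← this, Finset.sum_mul]
      refine Finset.sum_congr rfl fun k _ => ?_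
      have : (Pi.single k 1 : Fin 3 → ℂ) = fun j => if k = j then 1 else 0 := by
        ext j; simp [Pi.single_apply, eq_comm]
      rw [this]; ring
    exact (mul_eq_zero.1 e).resolve_right hx
  refine LinearMap.pi_ext' fun k => LinearMap.ext_ring ?_
  simpa using congrFun hc k

lemma finrank_ker (h : IsPolarPair a x b c) (ha : Function.Injective a) :
    Module.finrank ℂ (LinearMap.ker (jacobianMap a x)) = 3 := by
  have := LinearMap.finrank_range_add_finrank_ker (jacobianMap a x)
  rw [h.jacobianMap_surjective ha, finrank_top] at this
  simp at this
  omega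

lemma self_mem_ker (h : IsPolarPair a x b c) : x ∈ LinearMap.ker (jacobianMap a x) := by
  refine LinearMap.mem_ker.2 (funext fun k => ?_)
  simpa [jacobianMap_apply, pow_two, mul_assoc] using h.moment k

lemma left_mem_ker (h : IsPolarPair a x b c) :
    polarVec a x b ∈ LinearMap.ker (jacobianMap a x) :=
  LinearMap.mem_ker.2 (funext h.sum_left)

lemma span_eq_ker (h : IsPolarPair a x b c) (ha : Function.Injective a) :
    Submodule.span ℂ {x, polarVec a x b, polarVec a x c} = LinearMap.ker (jacobianMap a x) := by
  refine Submodule.eq_of_le_of_finrank_eq ?_ ?_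
  · rw [Submodule.span_le]
    rintro w (rfl | rfl | rfl)
    exacts [h.self_mem_ker, h.left_mem_ker, h.symm.left_mem_ker]
  · have := finrank_span_eq_card (h.linearIndependent ha)
    rw [h.finrank_ker ha]
    rw [Matrix.range_cons, Matrix.range_cons_cons_empty, Set.singleton_union] at this
    simpa using this

lemma exists_eq_of_mem_ker (h : IsPolarPair a x b c) (ha : Function.Injective a) {w : HomCoord 5}
    (hw : w ∈ LinearMap.ker (jacobianMap a x)) :
    ∃ z : ℂ, w = z • x + h.leftCoord w • polarVec a x b + h.rightCoord w • polarVec a x c := by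
  rw [← h.span_eq_ker ha, Submodule.mem_span_triple] at hw
  obtain ⟨z, p, q, rfl⟩ := hw
  refine ⟨z, ?_⟩
  simp [h.leftCoord_self, h.leftCoord_left ha, h.leftCoord_right,
    h.rightCoord_self, h.rightCoord_left, h.rightCoord_right ha]

/-- The simultaneous diagonalization behind the whole proof: in the basis `x`, `polarVec a x b`,
`polarVec a x c` all mixed terms vanish, `x` is in the radical, and only the two squares survive. -/
lemma sum_mul_of_mem_ker (h : IsPolarPair a x b c) (ha : Function.Injective a) {v w : HomCoord 5}
    (hv : v ∈ LinearMap.ker (jacobianMap a x)) (hw : w ∈ LinearMap.ker (jacobianMap a x))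
    (k : Fin 3) :
    ∑ i, a i ^ (k : ℕ) * (v i * w i) =
      (∑ i, polarVec a x b i ^ 2) * b ^ (k : ℕ) * (h.leftCoord v * h.leftCoord w) +
      (∑ i, polarVec a x c i ^ 2) * c ^ (k : ℕ) * (h.rightCoord v * h.rightCoord w) := by
  obtain ⟨z, hv⟩ := h.exists_eq_of_mem_ker ha hv
  obtain ⟨z', hw⟩ := h.exists_eq_of_mem_ker ha hw
  generalize h.leftCoord v = p at *
  generalize h.leftCoord w = p' at *
  generalize h.rightCoord v = q at *
  generalize h.rightCoord w = q' at *
  have e : ∑ i, a i ^ (k : ℕ) * (v i * w i) =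
      z * z' * ∑ i, a i ^ (k : ℕ) * x i ^ 2 +
      (z * p' + z' * p) * ∑ i, a i ^ (k : ℕ) * x i * polarVec a x b i +
      (z * q' + z' * q) * ∑ i, a i ^ (k : ℕ) * x i * polarVec a x c i +
      p * p' * ∑ i, a i ^ (k : ℕ) * polarVec a x b i ^ 2 +
      q * q' * ∑ i, a i ^ (k : ℕ) * polarVec a x c i ^ 2 +
      (p * q' + p' * q) * ∑ i, a i ^ (k : ℕ) * (polarVec a x b i * polarVec a x c i) := by
    simp only [Finset.mul_sum, ← Finset.sum_add_distrib]
    refine Finset.sum_congr rfl fun i _ => ?_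
    rw [hv, hw]
    simp only [Pi.add_apply, Pi.smul_apply, smul_eq_mul]
    ring
  rw [e, h.moment, h.sum_left, h.symm.sum_left, h.sum_sq, h.symm.sum_sq, h.sum_mixed]
  ring

end IsPolarPair

/-! ### Differentiating the equations along a parametrization -/

/-- First and second derivatives of an analytic map into a diagonal quadric. -/
lemma sum_mul_fderiv_eq_zero {n : ℕ} {ι : Type*} [Fintype ι] {φ : (Fin n → ℂ) → ι → ℂ} (hφ : AnalyticAt ℂ φ 0)
    {d : ι → ℂ} (h0 : ∀ᶠ t in 𝓝 0, ∑ i, d i * φ t i ^ 2 = 0) :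
    (∀ u, ∑ i, d i * φ 0 i * fderiv ℂ φ 0 u i = 0) ∧
    ∀ u v, ∑ i, d i * φ 0 i * fderiv ℂ (fderiv ℂ φ) 0 u v i =
      -∑ i, d i * (fderiv ℂ φ 0 u i * fderiv ℂ φ 0 v i) := by
  have hd : ∀ᶠ t in 𝓝 0, HasFDerivAt φ (fderiv ℂ φ t) t :=
    hφ.eventually_analyticAt.mono fun t ht => ht.differentiableAt.hasFDerivAt
  have h1 : ∀ᶠ t in 𝓝 0, ∀ u, ∑ i, d i * φ t i * fderiv ℂ φ t u i = 0 := by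
    filter_upwards [hd, h0.eventually_nhds] with t ht hz u
    have hi (i : ι) := (hasFDerivAt_pi'.1 ht i)
    have hs : HasFDerivAt (fun s => ∑ i, d i * φ s i ^ 2) _ t :=
      HasFDerivAt.fun_sum fun i _ => ((hi i).pow 2).const_mul (d i)
    have hz' : HasFDerivAt (fun s => ∑ i, d i * φ s i ^ 2) (0 : (Fin n → ℂ) →L[ℂ] ℂ) t :=
      (hasFDerivAt_const (0 : ℂ) t).congr_of_eventuallyEq hz
    have := DFunLike.congr_fun (hs.unique hz') u
    simp only [sum_apply, smul_apply,
      ContinuousLinearMap.comp_apply, ContinuousLinearMap.proj_apply, smul_eq_mul,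
      zero_apply] at this
    have e : 2 * ∑ i, d i * φ t i * fderiv ℂ φ t u i = 0 := by
      rw [← this, Finset.mul_sum]
      exact Finset.sum_congr rfl fun i _ => by simp; ring
    simpa using e
  refine ⟨h1.self_of_nhds, fun u v => ?_⟩
  have hi (i : ι) := (hasFDerivAt_pi'.1 hd.self_of_nhds i)
  have h2 : HasFDerivAt (fderiv ℂ φ) (fderiv ℂ (fderiv ℂ φ) 0) 0 :=
    hφ.fderiv.differentiableAt.hasFDerivAt
  have h2i (i : ι) := hasFDerivAt_pi'.1 (h2.clm_apply (hasFDerivAt_const v 0)) i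
  -- The first-order identity holds on a neighbourhood, so it can be differentiated again, with `v`
  -- held fixed.
  have hs : HasFDerivAt (fun s => ∑ i, d i * φ s i * fderiv ℂ φ s v i) _ 0 :=
    HasFDerivAt.fun_sum fun i _ => ((hi i).const_mul (d i)).mul (h2i i)
  have hz' : HasFDerivAt (fun s => ∑ i, d i * φ s i * fderiv ℂ φ s v i)
      (0 : (Fin n → ℂ) →L[ℂ] ℂ) 0 :=
    (hasFDerivAt_const (0 : ℂ) _).congr_of_eventuallyEq (h1.mono fun t ht => ht v)
  have := DFunLike.congr_fun (hs.unique hz') u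
  simp only [sum_apply, smul_apply,
    ContinuousLinearMap.comp_apply, ContinuousLinearMap.proj_apply, smul_eq_mul,
    zero_apply, add_apply] at this
  rw [← add_eq_zero_iff_eq_neg, ← Finset.sum_add_distrib, ← this]
  exact Finset.sum_congr rfl fun i _ => by simp; ring

/-! ### Local parametrizations -/

lemma quadric_eq (a : Fin 6 → ℂ) (k : Fin 3) (w : HomCoord 5) :
    kummerQuadric a k w = ∑ i, a i ^ (k : ℕ) * w i ^ 2 := by
  simp [kummerQuadric, QuadraticMap.weightedSumSquares_apply, pow_two]

lemma mk_mem_kummerSurface (a : Fin 6 → ℂ) {w : HomCoord 5} (hw : w ≠ 0) :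
    Projectivization.mk ℂ w hw ∈ kummerSurface a ↔
      ∀ k : Fin 3, ∑ i, a i ^ (k : ℕ) * w i ^ 2 = 0 := by
  obtain ⟨s, hs⟩ := Projectivization.exists_smul_eq_mk_rep ℂ w hw
  refine forall_congr' fun k => ?_
  rw [← hs, ← quadric_eq]
  rw [Units.smul_def, QuadraticMap.map_smul]
  simp

lemma mem_puncturedCone_kummerSurface (a : Fin 6 → ℂ) {w : HomCoord 5} :
    w ∈ puncturedCone (kummerSurface a) ↔
      w ≠ 0 ∧ ∀ k : Fin 3, ∑ i, a i ^ (k : ℕ) * w i ^ 2 = 0 :=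
  ⟨fun ⟨h, h'⟩ => ⟨h, (mk_mem_kummerSurface a h).1 h'⟩,
    fun ⟨h, h'⟩ => ⟨h, (mk_mem_kummerSurface a h).2 h'⟩⟩

namespace IsLocalParametrization

variable {N : ℕ} {X : Set (ProjSpace N)} {y : ProjSpace N} {φ : (Fin 2 → ℂ) → HomCoord N}

lemma ne_zero (h : IsLocalParametrization X y φ) : φ 0 ≠ 0 := h.immersive.ne_zero 0

lemma eventually_mem (h : IsLocalParametrization X y φ) :
    ∀ᶠ t in 𝓝 0, φ t ∈ puncturedCone X := by
  have h1 : Filter.Tendsto (fun p : ℂ × (Fin 2 → ℂ) => p.1 • φ p.2) (𝓝 (1, 0))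
      (𝓝[puncturedCone X] (φ 0)) := h.map_nhds.le
  have h2 : Filter.Tendsto (fun t : Fin 2 → ℂ => ((1 : ℂ), t)) (𝓝 0) (𝓝 (1, 0)) :=
    Continuous.tendsto (by fun_prop) 0
  have := (h1.comp h2).eventually eventually_mem_nhdsWithin
  simpa using this

lemma exists_base_eq (h : IsLocalParametrization X y φ) : ∃ s : ℂ, s ≠ 0 ∧ φ 0 = s • y.rep := by
  have hb := h.base
  rw [Projectivization.submodule_eq, Submodule.mem_span_singleton] at hb
  obtain ⟨s, hs⟩ := hb
  refine ⟨s, ?_, hs.symm⟩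
  rintro rfl
  exact h.ne_zero (by rw [← hs, zero_smul])

lemma submodule_eq (h : IsLocalParametrization X y φ) : y.submodule = ℂ ∙ φ 0 := by
  obtain ⟨s, hs, e⟩ := h.exists_base_eq
  rw [Projectivization.submodule_eq, e, Submodule.span_singleton_smul_eq (isUnit_iff_ne_zero.2 hs)]

end IsLocalParametrization

lemma mem_tangentPlaneCone {N : ℕ} {φ : (Fin 2 → ℂ) → HomCoord N} {w : HomCoord N} :
    w ∈ tangentPlaneCone φ ↔ ∃ (z : ℂ) (u : Fin 2 → ℂ), w = z • φ 0 + fderiv ℂ φ 0 u := by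
  constructor
  · intro hw
    induction hw using Submodule.span_induction with
    | mem w hw =>
      obtain ⟨k, hk, m, rfl⟩ := hw
      interval_cases k
      · exact ⟨1, 0, by simp⟩
      · exact ⟨0, m 0, by simp⟩
    | zero => exact ⟨0, 0, by simp⟩
    | add v w _ _ hv hw =>
      obtain ⟨z, u, rfl⟩ := hv
      obtain ⟨z', u', rfl⟩ := hw
      exact ⟨z + z', u + u', by rw [add_smul, map_add]; abel⟩
    | smul s v _ hv =>
      obtain ⟨z, u, rfl⟩ := hv
      exact ⟨s * z, s • u, by simp [mul_smul]⟩
  · rintro ⟨z, u, rfl⟩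
    refine add_mem (Submodule.smul_mem _ _ (Submodule.subset_span ⟨0, by simp, ![], by simp⟩))
      (Submodule.subset_span ⟨1, le_rfl, ![u], by simp⟩)

lemma osculatingCone_two {N : ℕ} (φ : (Fin 2 → ℂ) → HomCoord N) :
    osculatingCone φ 2 = tangentPlaneCone φ ⊔
      Submodule.span ℂ {w | ∃ u v, w = fderiv ℂ (fderiv ℂ φ) 0 u v} := by
  rw [tangentPlaneCone, osculatingCone, osculatingCone, ← Submodule.span_union]
  congr 1
  ext w
  constructor
  · rintro ⟨k, hk, m, rfl⟩
    rcases Nat.lt_or_ge k 2 with h | h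
    · exact Or.inl ⟨k, by omega, m, rfl⟩
    · obtain rfl : k = 2 := le_antisymm hk h
      exact Or.inr ⟨m 0, m 1, iteratedFDeriv_two_apply _ _ _⟩
  · rintro (⟨k, hk, m, rfl⟩ | ⟨u, v, rfl⟩)
    · exact ⟨k, by omega, m, rfl⟩
    · exact ⟨2, le_rfl, ![u, v], by simp [iteratedFDeriv_two_apply]⟩

/-- Linear interpolation at the two zeros. It shows that the quadrics with k = 0 and k = 1 already
produce every pair of coefficients of X^2 and Y^2. -/
lemma exists_affine_eq {b c : ℂ} (h : b ≠ c) (α β : ℂ) :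
    ∃ r s : ℂ, r + s * b = α ∧ r + s * c = β := by
  have := sub_ne_zero.2 h
  refine ⟨α - (α - β) / (b - c) * b, (α - β) / (b - c), by ring, ?_⟩
  field_simp
  ring

lemma finrank_span_pair_eq_two {V : Type*} [AddCommGroup V] [Module ℂ V] {v w : V}
    (h : LinearIndependent ℂ ![v, w]) : Module.finrank ℂ (Submodule.span ℂ {v, w}) = 2 := by
  rw [← Matrix.range_cons_cons_empty v w ![], finrank_span_eq_card h, Fintype.card_fin]

/-! ### The second fundamental form in the polar basis -/

namespace IsPolarPair

variable {a : Fin 6 → ℂ} {b c : ℂ} {y : ProjSpace 5} {φ : (Fin 2 → ℂ) → HomCoord 5}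

/-- The differentiated equations give one inclusion; immersivity makes the left side at least
three-dimensional, which is the dimension of the kernel. -/
lemma tangentPlaneCone_eq (h : IsPolarPair a (φ 0) b c) (ha : Function.Injective a)
    (hφ : IsLocalParametrization (kummerSurface a) y φ) :
    tangentPlaneCone φ = LinearMap.ker (jacobianMap a (φ 0)) := by
  have hd (u : Fin 2 → ℂ) : fderiv ℂ φ 0 u ∈ LinearMap.ker (jacobianMap a (φ 0)) := by
    refine LinearMap.mem_ker.2 (funext fun k => ?_)
    refine (sum_mul_fderiv_eq_zero hφ.analyticAt (d := fun i => a i ^ (k : ℕ)) ?_).1 u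
    exact hφ.eventually_mem.mono fun t ht => ((mem_puncturedCone_kummerSurface a).1 ht).2 k
  refine Submodule.eq_of_le_of_finrank_le ?_ ?_
  · intro w hw
    obtain ⟨z, u, rfl⟩ := mem_tangentPlaneCone.1 hw
    exact add_mem (Submodule.smul_mem _ _ h.self_mem_ker) (hd u)
  · rw [h.finrank_ker ha]
    have := finrank_span_eq_card hφ.immersive
    refine this.symm.trans_le ?_
    refine Submodule.finrank_mono (Submodule.span_le.2 ?_)
    rintro _ ⟨i, rfl⟩
    fin_cases i
    · exact mem_tangentPlaneCone.2 ⟨1, 0, by simp⟩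
    · exact mem_tangentPlaneCone.2 ⟨0, Pi.single 0 1, by simp⟩
    · exact mem_tangentPlaneCone.2 ⟨0, Pi.single 1 1, by simp⟩

lemma fderiv_mem_ker (h : IsPolarPair a (φ 0) b c) (ha : Function.Injective a)
    (hφ : IsLocalParametrization (kummerSurface a) y φ) (u : Fin 2 → ℂ) :
    fderiv ℂ φ 0 u ∈ LinearMap.ker (jacobianMap a (φ 0)) := by
  rw [← h.tangentPlaneCone_eq ha hφ]
  exact mem_tangentPlaneCone.2 ⟨0, u, by simp⟩

/-- The first coordinate of a tangent vector in the basis that diagonalizes the second fundamental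
form. -/
def leftTangent (h : IsPolarPair a (φ 0) b c) : (Fin 2 → ℂ) →ₗ[ℂ] ℂ :=
  h.leftCoord ∘ₗ (fderiv ℂ φ 0).toLinearMap

/-- The second coordinate of a tangent vector in the basis that diagonalizes the second fundamental
form. -/
def rightTangent (h : IsPolarPair a (φ 0) b c) : (Fin 2 → ℂ) →ₗ[ℂ] ℂ :=
  h.rightCoord ∘ₗ (fderiv ℂ φ 0).toLinearMap

lemma leftTangent_apply (h : IsPolarPair a (φ 0) b c) (u : Fin 2 → ℂ) :
    h.leftTangent u = h.leftCoord (fderiv ℂ φ 0 u) := rfl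

lemma rightTangent_apply (h : IsPolarPair a (φ 0) b c) (u : Fin 2 → ℂ) :
    h.rightTangent u = h.rightCoord (fderiv ℂ φ 0 u) := rfl

lemma exists_tangent (h : IsPolarPair a (φ 0) b c) (ha : Function.Injective a)
    (hφ : IsLocalParametrization (kummerSurface a) y φ) (α β : ℂ) :
    ∃ u, h.leftTangent u = α ∧ h.rightTangent u = β := by
  have hw : α • polarVec a (φ 0) b + β • polarVec a (φ 0) c ∈ tangentPlaneCone φ := by
    rw [h.tangentPlaneCone_eq ha hφ]
    exact add_mem (Submodule.smul_mem _ _ h.left_mem_ker)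
      (Submodule.smul_mem _ _ h.symm.left_mem_ker)
  obtain ⟨z, u, e⟩ := mem_tangentPlaneCone.1 hw
  refine ⟨u, ?_, ?_⟩
  · simpa [leftTangent_apply, h.leftCoord_self, h.leftCoord_left ha, h.leftCoord_right, eq_comm]
      using congrArg h.leftCoord e
  · simpa [rightTangent_apply, h.rightCoord_self, h.rightCoord_right ha, h.rightCoord_left, eq_comm]
      using congrArg h.rightCoord e

/-- The kernel of `jacobianMap` is the tangent plane, so this map identifies the normal space with
`ℂ^3`. There the second fundamental form becomes minus the restriction of the three quadrics to the
tangent plane, which links the two involutions. -/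
lemma jacobianMap_fderiv_fderiv (h : IsPolarPair a (φ 0) b c) (ha : Function.Injective a)
    (hφ : IsLocalParametrization (kummerSurface a) y φ) (u v : Fin 2 → ℂ) (k : Fin 3) :
    jacobianMap a (φ 0) (fderiv ℂ (fderiv ℂ φ) 0 u v) k =
      -((∑ i, polarVec a (φ 0) b i ^ 2) * b ^ (k : ℕ) * (h.leftTangent u * h.leftTangent v) +
      (∑ i, polarVec a (φ 0) c i ^ 2) * c ^ (k : ℕ) * (h.rightTangent u * h.rightTangent v)) := by
  rw [jacobianMap_apply, leftTangent_apply, leftTangent_apply, rightTangent_apply,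
    rightTangent_apply, ← h.sum_mul_of_mem_ker ha (h.fderiv_mem_ker ha hφ u)
    (h.fderiv_mem_ker ha hφ v) k]
  refine (sum_mul_fderiv_eq_zero hφ.analyticAt (d := fun i => a i ^ (k : ℕ)) ?_).2 u v
  exact hφ.eventually_mem.mono fun t ht => ((mem_puncturedCone_kummerSurface a).1 ht).2 k

/-- Two normal vectors in which the second fundamental form is diagonal. -/
lemma exists_normal (h : IsPolarPair a (φ 0) b c) (ha : Function.Injective a)
    (hφ : IsLocalParametrization (kummerSurface a) y φ) :
    ∃ n₁ n₂ : HomCoord 5, n₁ ∈ osculatingCone φ 2 ∧ n₂ ∈ osculatingCone φ 2 ∧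
      (∀ r s : ℂ, r • n₁ + s • n₂ ∈ tangentPlaneCone φ → r = 0 ∧ s = 0) ∧
      ∀ u v, fderiv ℂ (fderiv ℂ φ) 0 u v - ((h.leftTangent u * h.leftTangent v) • n₁ +
        (h.rightTangent u * h.rightTangent v) • n₂) ∈ tangentPlaneCone φ := by
  obtain ⟨u₁, h11, h12⟩ := h.exists_tangent ha hφ 1 0
  obtain ⟨u₂, h21, h22⟩ := h.exists_tangent ha hφ 0 1
  have mem (u v : Fin 2 → ℂ) : fderiv ℂ (fderiv ℂ φ) 0 u v ∈ osculatingCone φ 2 := by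
    rw [osculatingCone_two]
    exact Submodule.mem_sup_right (Submodule.subset_span ⟨u, v, rfl⟩)
  -- The normal vectors are the second derivatives along the two polar directions; their
  -- independence comes from the components k = 0, 1, a Vandermonde system in b, c.
  refine ⟨_, _, mem u₁ u₁, mem u₂ u₂, ?_, ?_⟩
  · intro r s hrs
    rw [h.tangentPlaneCone_eq ha hφ, LinearMap.mem_ker, map_add, map_smul, map_smul] at hrs
    have e0 := congrFun hrs 0
    have e1 := congrFun hrs 1
    simp only [Pi.add_apply, Pi.smul_apply, smul_eq_mul, h.jacobianMap_fderiv_fderiv ha hφ,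
      h11, h12, h21, h22, Fin.val_zero, Fin.val_one, Pi.zero_apply, pow_zero, pow_one, mul_one,
      mul_zero, add_zero, zero_add] at e0 e1
    have hA := h.sum_sq_ne_zero ha
    have hB := h.symm.sum_sq_ne_zero ha
    have hne := sub_ne_zero.2 h.ne
    constructor
    · have : (b - c) * (∑ i, polarVec a (φ 0) b i ^ 2) * r = 0 := by
        linear_combination c * e0 - e1
      simpa [hne, hA] using this
    · have : (b - c) * (∑ i, polarVec a (φ 0) c i ^ 2) * s = 0 := by
        linear_combination e1 - b * e0
      simpa [hne, hB] using this
  · intro u v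
    rw [h.tangentPlaneCone_eq ha hφ, LinearMap.mem_ker, map_sub, map_add, map_smul, map_smul]
    ext k
    simp only [Pi.add_apply, Pi.sub_apply, Pi.smul_apply, smul_eq_mul,
      h.jacobianMap_fderiv_fderiv ha hφ, h11, h12, h21, h22, Pi.zero_apply]
    ring

lemma finrank_osculatingCone_two (h : IsPolarPair a (φ 0) b c) (ha : Function.Injective a)
    (hφ : IsLocalParametrization (kummerSurface a) y φ) :
    Module.finrank ℂ (osculatingCone φ 2) = 5 := by
  obtain ⟨n₁, n₂, m₁, m₂, hind, hII⟩ := h.exists_normal ha hφ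
  have e : osculatingCone φ 2 = tangentPlaneCone φ ⊔ Submodule.span ℂ {n₁, n₂} := by
    apply le_antisymm
    · rw [osculatingCone_two]
      refine sup_le le_sup_left (Submodule.span_le.2 ?_)
      rintro _ ⟨u, v, rfl⟩
      rw [← sub_add_cancel (fderiv ℂ (fderiv ℂ φ) 0 u v) ((h.leftTangent u * h.leftTangent v) • n₁ +
        (h.rightTangent u * h.rightTangent v) • n₂)]
      exact add_mem (Submodule.mem_sup_left (hII u v))
        (Submodule.mem_sup_right (Submodule.mem_span_pair.2 ⟨_, _, rfl⟩))
    · refine sup_le ?_ (Submodule.span_le.2 ?_)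
      · rw [osculatingCone_two]; exact le_sup_left
      · rintro _ (rfl | rfl) <;> assumption
  have hdisj : tangentPlaneCone φ ⊓ Submodule.span ℂ {n₁, n₂} = ⊥ := by
    rw [eq_bot_iff]
    rintro w ⟨hT, hS⟩
    obtain ⟨r, s, rfl⟩ := Submodule.mem_span_pair.1 hS
    obtain ⟨rfl, rfl⟩ := hind r s hT
    simp
  have h2 : Module.finrank ℂ (Submodule.span ℂ {n₁, n₂}) = 2 := by
    have hli : LinearIndependent ℂ ![n₁, n₂] :=
      LinearIndependent.pair_iff.2 fun r s hrs => hind r s (by rw [hrs]; exact zero_mem _)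
    exact finrank_span_pair_eq_two hli
  have := Submodule.finrank_sup_add_finrank_inf_eq (tangentPlaneCone φ) (Submodule.span ℂ {n₁, n₂})
  rw [hdisj, finrank_bot, ← e, h2, h.tangentPlaneCone_eq ha hφ, h.finrank_ker ha] at this
  simpa using this

lemma secondFundamentalSystem_eq (h : IsPolarPair a (φ 0) b c) (ha : Function.Injective a)
    (hφ : IsLocalParametrization (kummerSurface a) y φ) :
    secondFundamentalSystem φ = Submodule.span ℂ
      {QuadraticMap.linMulLin h.leftTangent h.leftTangent,
        QuadraticMap.linMulLin h.rightTangent h.rightTangent} := by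
  ext q
  rw [Submodule.mem_span_pair]
  constructor
  · rintro ⟨f, rfl⟩
    obtain ⟨n₁, n₂, m₁, m₂, hind, hII⟩ := h.exists_normal ha hφ
    refine ⟨f ((tangentPlaneCone φ).mkQ n₁), f ((tangentPlaneCone φ).mkQ n₂), ?_⟩
    ext u
    have := (Submodule.Quotient.eq _).2 (hII u u)
    change _ = f ((tangentPlaneCone φ).mkQ (fderiv ℂ (fderiv ℂ φ) 0 u u))
    rw [Submodule.mkQ_apply _ (fderiv ℂ (fderiv ℂ φ) 0 u u), this, ← Submodule.mkQ_apply]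
    simp [mul_comm]
  · rintro ⟨α, β, rfl⟩
    have hA := h.sum_sq_ne_zero ha
    have hB := h.symm.sum_sq_ne_zero ha
    -- The normal form with components r, s in degrees k = 0, 1 yields -(r + s b) A X^2 - (r + s c)
    -- B Y^2; r and s are solved for so that this equals α X^2 + β Y^2.
    obtain ⟨r, s, hr, hs⟩ := exists_affine_eq h.ne (-α / ∑ i, polarVec a (φ 0) b i ^ 2)
      (-β / ∑ i, polarVec a (φ 0) c i ^ 2)
    rw [eq_div_iff hA] at hr
    rw [eq_div_iff hB] at hs
    let f : HomCoord 5 →ₗ[ℂ] ℂ :=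
      (r • LinearMap.proj (0 : Fin 3) + s • LinearMap.proj (1 : Fin 3)) ∘ₗ jacobianMap a (φ 0)
    have hf : tangentPlaneCone φ ≤ LinearMap.ker f := by
      rw [h.tangentPlaneCone_eq ha hφ]
      exact LinearMap.ker_le_ker_comp _ _
    refine ⟨(tangentPlaneCone φ).liftQ f hf, ?_⟩
    ext u
    change r * jacobianMap a (φ 0) (fderiv ℂ (fderiv ℂ φ) 0 u u) 0 +
      s * jacobianMap a (φ 0) (fderiv ℂ (fderiv ℂ φ) 0 u u) 1 =
      α * (h.leftTangent u * h.leftTangent u) + β * (h.rightTangent u * h.rightTangent u)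
    simp only [h.jacobianMap_fderiv_fderiv ha hφ, Fin.val_zero, Fin.val_one, pow_zero, pow_one]
    linear_combination (-(h.leftTangent u * h.leftTangent u)) * hr
      - (h.rightTangent u * h.rightTangent u) * hs

lemma finrank_secondFundamentalSystem (h : IsPolarPair a (φ 0) b c) (ha : Function.Injective a)
    (hφ : IsLocalParametrization (kummerSurface a) y φ) :
    Module.finrank ℂ (secondFundamentalSystem φ) = 2 := by
  have hli : LinearIndependent ℂ ![QuadraticMap.linMulLin h.leftTangent h.leftTangent,
      QuadraticMap.linMulLin h.rightTangent h.rightTangent] := by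
    refine LinearIndependent.pair_iff.2 fun r s hrs => ?_
    obtain ⟨u₁, h11, h12⟩ := h.exists_tangent ha hφ 1 0
    obtain ⟨u₂, h21, h22⟩ := h.exists_tangent ha hφ 0 1
    have e1 := DFunLike.congr_fun hrs u₁
    have e2 := DFunLike.congr_fun hrs u₂
    constructor
    · simpa [h11, h12] using e1
    · simpa [h21, h22] using e2
  rw [h.secondFundamentalSystem_eq ha hφ]
  exact finrank_span_pair_eq_two hli

end IsPolarPair

/-! ### The involution of the pencil of tangent lines -/

/-- An involution of a pencil of lines is determined by its pairs of lines. -/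
lemma eq_of_involutionPairs_eq {N : ℕ} {y : ProjSpace N} {T : Submodule ℂ (HomCoord N)}
    {σ τ : LinePencil y T → LinePencil y T} (hσ : ∀ L, σ (σ L) = L)
    (h : involutionPairs τ = involutionPairs σ) : τ = σ := by
  have key {L M M' : LinePencil y T} (hL : (L.1 : Set (HomCoord N)) ⊆ (M.1 : Set (HomCoord N)) ∪ M'.1) :
      L = M ∨ L = M' := by
    -- A subspace inside a union of two subspaces lies in one of them: otherwise the sum of two
    -- witnesses lies in neither.
    have hle : L.1 ≤ M.1 ∨ L.1 ≤ M'.1 := by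
      by_contra! hne
      obtain ⟨⟨v, hv, hv'⟩, w, hw, hw'⟩ := And.imp SetLike.not_le_iff_exists.1
        SetLike.not_le_iff_exists.1 hne
      have hv2 : v ∈ M'.1 := (hL hv).resolve_left hv'
      have hw2 : w ∈ M.1 := (hL hw).resolve_right hw'
      rcases hL (add_mem hv hw) with hs | hs
      · exact hv' ((Submodule.add_mem_iff_left _ hw2).1 hs)
      · exact hw' ((Submodule.add_mem_iff_right _ hv2).1 hs)
    exact hle.imp (fun h => Subtype.ext (Submodule.eq_of_le_of_finrank_eq h (by rw [L.2.2.2, M.2.2.2])))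
      (fun h => Subtype.ext (Submodule.eq_of_le_of_finrank_eq h (by rw [L.2.2.2, M'.2.2.2])))
  funext L
  obtain ⟨M, hM⟩ : (L.1 : Set (HomCoord N)) ∪ (τ L).1 ∈ involutionPairs σ := h ▸ ⟨L, rfl⟩
  have e : (L.1 : Set (HomCoord N)) ∪ (τ L).1 = (L.1 : Set (HomCoord N)) ∪ (σ L).1 := by
    rcases key (hM ▸ Set.subset_union_left) with rfl | rfl
    · exact hM.symm
    · rw [hσ, ← hM, Set.union_comm]
  have h1 : τ L = L ∨ τ L = σ L := key (e ▸ Set.subset_union_right)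
  have h2 : σ L = L ∨ σ L = τ L := key (e ▸ Set.subset_union_right)
  rcases h2 with h2 | h2
  · rcases h1 with h1 | h1
    · rw [h1, h2]
    · exact h1
  · exact h2.symm

namespace IsPolarPair

variable {a x : Fin 6 → ℂ} {b c : ℂ} {y : ProjSpace 5}

/-- The pair of tangent lines with equation `α X^2 + β Y^2 = 0`. -/
def tangentConic (h : IsPolarPair a x b c) (α β : ℂ) : Set (HomCoord 5) :=
  {w | w ∈ LinearMap.ker (jacobianMap a x) ∧ α * h.leftCoord w ^ 2 + β * h.rightCoord w ^ 2 = 0}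

/-- The linear map that changes the sign of the coefficient of `polarVec a x c`. -/
def reflection (h : IsPolarPair a x b c) : HomCoord 5 →ₗ[ℂ] HomCoord 5 :=
  LinearMap.id - (2 : ℂ) • h.rightCoord.smulRight (polarVec a x c)

lemma reflection_apply (h : IsPolarPair a x b c) (w : HomCoord 5) :
    h.reflection w = w - (2 * h.rightCoord w) • polarVec a x c := by
  simp [reflection, mul_smul]

lemma rightCoord_reflection (h : IsPolarPair a x b c) (ha : Function.Injective a)
    (w : HomCoord 5) : h.rightCoord (h.reflection w) = -h.rightCoord w := by
  simp only [reflection_apply, map_sub, map_smul, h.rightCoord_right ha, smul_eq_mul]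
  ring

lemma leftCoord_reflection (h : IsPolarPair a x b c) (w : HomCoord 5) :
    h.leftCoord (h.reflection w) = h.leftCoord w := by
  simp [reflection_apply, h.leftCoord_right]

lemma reflection_reflection (h : IsPolarPair a x b c) (ha : Function.Injective a)
    (w : HomCoord 5) : h.reflection (h.reflection w) = w := by
  rw [h.reflection_apply (h.reflection w), h.rightCoord_reflection ha, h.reflection_apply w,
    mul_neg, neg_smul, sub_neg_eq_add, sub_add_cancel]

lemma reflection_self (h : IsPolarPair a x b c) : h.reflection x = x := by
  simp [reflection_apply, h.rightCoord_self]

lemma reflection_mem_ker (h : IsPolarPair a x b c) {w : HomCoord 5}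
    (hw : w ∈ LinearMap.ker (jacobianMap a x)) :
    h.reflection w ∈ LinearMap.ker (jacobianMap a x) := by
  rw [reflection_apply]
  exact sub_mem hw (Submodule.smul_mem _ _ h.symm.left_mem_ker)

/-- The involution of the pencil of tangent lines induced by the reflection. -/
def lineInvolution (h : IsPolarPair a x b c) (ha : Function.Injective a)
    (hy : y.submodule = ℂ ∙ x)
    (L : LinePencil y (LinearMap.ker (jacobianMap a x))) :
    LinePencil y (LinearMap.ker (jacobianMap a x)) :=
  ⟨L.1.map h.reflection, by
    have hx : x ∈ L.1 := L.2.1 (hy ▸ Submodule.mem_span_singleton_self x)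
    exact hy.le.trans ((Submodule.span_singleton_le_iff_mem _ _).2 ⟨x, hx, h.reflection_self⟩), by
    rintro _ ⟨w, hw, rfl⟩
    exact h.reflection_mem_ker (L.2.2.1 hw), by
    have hinj : Function.Injective h.reflection :=
      (show Function.Involutive h.reflection from h.reflection_reflection ha).injective
    exact (Submodule.equivMapOfInjective _ hinj L.1).finrank_eq.symm.trans L.2.2.2⟩

lemma mem_lineInvolution (h : IsPolarPair a x b c) (ha : Function.Injective a)
    (hy : y.submodule = ℂ ∙ x) (L : LinePencil y (LinearMap.ker (jacobianMap a x)))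
    (w : HomCoord 5) : w ∈ (h.lineInvolution ha hy L).1 ↔ h.reflection w ∈ L.1 := by
  constructor
  · rintro ⟨v, hv, rfl⟩
    rwa [h.reflection_reflection ha]
  · intro hw
    exact ⟨_, hw, h.reflection_reflection ha w⟩

lemma lineInvolution_lineInvolution (h : IsPolarPair a x b c) (ha : Function.Injective a)
    (hy : y.submodule = ℂ ∙ x) (L : LinePencil y (LinearMap.ker (jacobianMap a x))) :
    h.lineInvolution ha hy (h.lineInvolution ha hy L) = L := by
  refine Subtype.ext (Submodule.ext fun w => ?_)
  rw [mem_lineInvolution, mem_lineInvolution, h.reflection_reflection ha]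

/-- The equation of a tangent line. -/
lemma mem_line_iff (h : IsPolarPair a x b c) (ha : Function.Injective a)
    (hy : y.submodule = ℂ ∙ x) (L : LinePencil y (LinearMap.ker (jacobianMap a x)))
    {v : HomCoord 5} (hv : v ∈ L.1) (hne : h.leftCoord v ≠ 0 ∨ h.rightCoord v ≠ 0)
    (w : HomCoord 5) :
    w ∈ L.1 ↔ w ∈ LinearMap.ker (jacobianMap a x) ∧
      h.leftCoord w * h.rightCoord v = h.rightCoord w * h.leftCoord v := by
  have hx : x ∈ L.1 := L.2.1 (hy ▸ Submodule.mem_span_singleton_self x)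
  have hli : LinearIndependent ℂ ![x, v] := by
    refine LinearIndependent.pair_iff.2 fun r s hrs => ?_
    have e1 : s * h.leftCoord v = 0 := by
      simpa [h.leftCoord_self] using congrArg h.leftCoord hrs
    have e2 : s * h.rightCoord v = 0 := by
      simpa [h.rightCoord_self] using congrArg h.rightCoord hrs
    have hs : s = 0 := by
      rcases hne with hne | hne
      · exact (mul_eq_zero.1 e1).resolve_right hne
      · exact (mul_eq_zero.1 e2).resolve_right hne
    subst hs
    simpa [h.ne_zero] using hrs
  have hL : Submodule.span ℂ {x, v} = L.1 := by
    refine Submodule.eq_of_le_of_finrank_eq (Submodule.span_le.2 ?_) ?_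
    · rintro _ (rfl | rfl) <;> assumption
    · rw [finrank_span_pair_eq_two hli, L.2.2.2]
  constructor
  · intro hw
    refine ⟨L.2.2.1 hw, ?_⟩
    rw [← hL] at hw
    obtain ⟨r, s, rfl⟩ := Submodule.mem_span_pair.1 hw
    simp only [map_add, map_smul, h.leftCoord_self, h.rightCoord_self, smul_eq_mul]
    ring
  · rintro ⟨hw, e⟩
    obtain ⟨s, hs1, hs2⟩ : ∃ s, h.leftCoord w = s * h.leftCoord v ∧
        h.rightCoord w = s * h.rightCoord v := by
      rcases hne with hne | hne
      · refine ⟨h.leftCoord w / h.leftCoord v, by field_simp, ?_⟩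
        field_simp
        linear_combination -e
      · refine ⟨h.rightCoord w / h.rightCoord v, ?_, by field_simp⟩
        field_simp
        linear_combination e
    obtain ⟨z, hz⟩ := h.exists_eq_of_mem_ker ha hw
    obtain ⟨z', hz'⟩ := h.exists_eq_of_mem_ker ha (L.2.2.1 hv)
    have : w = (z - s * z') • x + s • v := by
      rw [hz, hs1, hs2]
      conv_rhs => rw [hz']
      module
    rw [this]
    exact add_mem (Submodule.smul_mem _ _ hx) (Submodule.smul_mem _ _ hv)

/-- The tangent line with given direction. -/
lemma exists_line (h : IsPolarPair a x b c) (ha : Function.Injective a)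
    (hy : y.submodule = ℂ ∙ x) {p q : ℂ} (hpq : p ≠ 0 ∨ q ≠ 0) :
    ∃ (L : LinePencil y (LinearMap.ker (jacobianMap a x))) (v : HomCoord 5), v ∈ L.1 ∧
      h.leftCoord v = p ∧ h.rightCoord v = q := by
  set v := p • polarVec a x b + q • polarVec a x c with hv
  have h1 : h.leftCoord v = p := by simp [hv, h.leftCoord_left ha, h.leftCoord_right]
  have h2 : h.rightCoord v = q := by simp [hv, h.rightCoord_right ha, h.rightCoord_left]
  have hli : LinearIndependent ℂ ![x, v] := by
    refine LinearIndependent.pair_iff.2 fun r s hrs => ?_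
    have e1 : s * p = 0 := by
      simpa [h.leftCoord_self, h1] using congrArg h.leftCoord hrs
    have e2 : s * q = 0 := by
      simpa [h.rightCoord_self, h2] using congrArg h.rightCoord hrs
    have hs : s = 0 := by
      rcases hpq with hne | hne
      · exact (mul_eq_zero.1 e1).resolve_right hne
      · exact (mul_eq_zero.1 e2).resolve_right hne
    subst hs
    simpa [h.ne_zero] using hrs
  refine ⟨⟨Submodule.span ℂ {x, v}, ?_, ?_, finrank_span_pair_eq_two hli⟩, v,
    Submodule.subset_span (by simp), h1, h2⟩
  · rw [hy, Submodule.span_singleton_le_iff_mem]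
    exact Submodule.subset_span (by simp)
  · rw [Submodule.span_le]
    rintro _ (rfl | rfl)
    · exact h.self_mem_ker
    · exact add_mem (Submodule.smul_mem _ _ h.left_mem_ker)
        (Submodule.smul_mem _ _ h.symm.left_mem_ker)

lemma exists_direction (h : IsPolarPair a x b c) (ha : Function.Injective a)
    (L : LinePencil y (LinearMap.ker (jacobianMap a x))) :
    ∃ v ∈ L.1, h.leftCoord v ≠ 0 ∨ h.rightCoord v ≠ 0 := by
  by_contra! hne
  have hle : L.1 ≤ ℂ ∙ x := by
    intro v hv
    obtain ⟨z, hz⟩ := h.exists_eq_of_mem_ker ha (L.2.2.1 hv)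
    rw [(hne v hv).1, (hne v hv).2, zero_smul, zero_smul, add_zero, add_zero] at hz
    exact Submodule.mem_span_singleton.2 ⟨z, hz.symm⟩
  have := Submodule.finrank_mono hle
  rw [L.2.2.2, finrank_span_singleton h.ne_zero] at this
  omega

/-- If `v` has coordinates (p, q), the line is q X - p Y = 0 and its reflection is q X + p Y = 0;
the union has the product as its equation. -/
lemma union_lineInvolution (h : IsPolarPair a x b c) (ha : Function.Injective a)
    (hy : y.submodule = ℂ ∙ x) (L : LinePencil y (LinearMap.ker (jacobianMap a x)))
    {v : HomCoord 5} (hv : v ∈ L.1) (hne : h.leftCoord v ≠ 0 ∨ h.rightCoord v ≠ 0) :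
    (L.1 : Set (HomCoord 5)) ∪ (h.lineInvolution ha hy L).1 =
      h.tangentConic (h.rightCoord v ^ 2) (-h.leftCoord v ^ 2) := by
  ext w
  have hT : h.reflection w ∈ LinearMap.ker (jacobianMap a x) ↔
      w ∈ LinearMap.ker (jacobianMap a x) :=
    ⟨fun hw => h.reflection_reflection ha w ▸ h.reflection_mem_ker hw, h.reflection_mem_ker⟩
  rw [Set.mem_union, SetLike.mem_coe, SetLike.mem_coe, mem_lineInvolution,
    h.mem_line_iff ha hy L hv hne, h.mem_line_iff ha hy L hv hne, hT, h.leftCoord_reflection,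
    h.rightCoord_reflection ha, ← and_or_left]
  refine and_congr_right fun _ => ?_
  rw [← sub_eq_zero, ← sub_eq_zero (b := -_ * _), ← mul_eq_zero]
  ring_nf

lemma isInvolution_lineInvolution (h : IsPolarPair a x b c) (ha : Function.Injective a)
    (hy : y.submodule = ℂ ∙ x) : IsInvolution (h.lineInvolution ha hy) := by
  refine ⟨⟨h.reflection, fun L => rfl⟩, fun hid => ?_, h.lineInvolution_lineInvolution ha hy⟩
  obtain ⟨L, v, hv, h1, h2⟩ := h.exists_line ha hy (p := 1) (q := 1) (Or.inl one_ne_zero)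
  have hm : h.reflection v ∈ L.1 := by
    rw [← mem_lineInvolution h ha hy, hid]
    exact hv
  rw [h.mem_line_iff ha hy L hv (by simp [h1]), h.leftCoord_reflection,
    h.rightCoord_reflection ha, h1, h2] at hm
  norm_num at hm

/-- Over `ℂ` one can write α = q^2 and β = -p^2, so every conic of the family splits into a line and
its reflection. -/
lemma involutionPairs_lineInvolution (h : IsPolarPair a x b c) (ha : Function.Injective a)
    (hy : y.submodule = ℂ ∙ x) : involutionPairs (h.lineInvolution ha hy) =
      {C | ∃ α β : ℂ, (α ≠ 0 ∨ β ≠ 0) ∧ C = h.tangentConic α β} := by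
  ext C
  constructor
  · rintro ⟨L, rfl⟩
    obtain ⟨v, hv, hne⟩ := h.exists_direction ha L
    exact ⟨_, _, by simpa [or_comm] using hne, h.union_lineInvolution ha hy L hv hne⟩
  · rintro ⟨α, β, hne, rfl⟩
    obtain ⟨q, hq⟩ := IsSquare.exists_sq α (IsAlgClosed.exists_eq_mul_self α)
    obtain ⟨p, hp⟩ := IsSquare.exists_sq (-β) (IsAlgClosed.exists_eq_mul_self (-β))
    have hpq : p ≠ 0 ∨ q ≠ 0 := by
      refine hne.symm.imp ?_ ?_
      · rintro hb rfl; exact hb (by simpa using hp)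
      · rintro hb rfl; exact hb (by simpa using hq)
    obtain ⟨L, v, hv, h1, h2⟩ := h.exists_line ha hy hpq
    refine ⟨L, ?_⟩
    have := h.union_lineInvolution ha hy L hv (by rwa [h1, h2])
    rwa [h1, h2, ← hp, ← hq, neg_neg] at this

/-- With m(t) = ∑ m_k t^k, the member ∑ m_k Q_k of the net restricts to A m(b) X^2 + B m(c) Y^2, and
the values m(b), m(c) are arbitrary. -/
lemma planeSections_eq (h : IsPolarPair a x b c) (ha : Function.Injective a) :
    planeSections (kummerNet a) (LinearMap.ker (jacobianMap a x)) =
      {C | ∃ α β : ℂ, (α ≠ 0 ∨ β ≠ 0) ∧ C = h.tangentConic α β} := by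
  have hA := h.sum_sq_ne_zero ha
  have hB := h.symm.sum_sq_ne_zero ha
  set A := ∑ i, polarVec a x b i ^ 2 with hA'
  set B := ∑ i, polarVec a x c i ^ 2 with hB'
  have eval (m : Fin 3 → ℂ) {w : HomCoord 5} (hw : w ∈ LinearMap.ker (jacobianMap a x)) :
      (∑ k, m k • kummerQuadric a k) w =
      (A * ∑ k, m k * b ^ (k : ℕ)) * h.leftCoord w ^ 2 +
      (B * ∑ k, m k * c ^ (k : ℕ)) * h.rightCoord w ^ 2 := by
    rw [sum_apply, Finset.mul_sum, Finset.mul_sum, Finset.sum_mul, Finset.sum_mul,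
      ← Finset.sum_add_distrib]
    refine Finset.sum_congr rfl fun k _ => ?_
    have := h.sum_mul_of_mem_ker ha hw hw k
    simp only [← pow_two] at this
    rw [smul_apply, quadric_eq, this, smul_eq_mul]
    ring
  have hnz (α β : ℂ) : (∃ w ∈ LinearMap.ker (jacobianMap a x),
      α * h.leftCoord w ^ 2 + β * h.rightCoord w ^ 2 ≠ 0) ↔ α ≠ 0 ∨ β ≠ 0 := by
    constructor
    · rintro ⟨w, -, hw⟩
      by_contra! h0
      exact hw (by simp [h0.1, h0.2])
    · rintro (h0 | h0)
      · exact ⟨_, h.left_mem_ker, by simpa [h.leftCoord_left ha, h.rightCoord_left] using h0⟩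
      · exact ⟨_, h.symm.left_mem_ker,
          by simpa [h.leftCoord_right, h.rightCoord_right ha] using h0⟩
  have hset (m : Fin 3 → ℂ) :
      {w | w ∈ LinearMap.ker (jacobianMap a x) ∧ (∑ k, m k • kummerQuadric a k) w = 0} =
      h.tangentConic (A * ∑ k, m k * b ^ (k : ℕ)) (B * ∑ k, m k * c ^ (k : ℕ)) := by
    ext w
    exact and_congr_right fun hw => by rw [eval m hw]
  have hex (m : Fin 3 → ℂ) :
      (∃ w ∈ LinearMap.ker (jacobianMap a x), (∑ k, m k • kummerQuadric a k) w ≠ 0) ↔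
      (A * ∑ k, m k * b ^ (k : ℕ)) ≠ 0 ∨ (B * ∑ k, m k * c ^ (k : ℕ)) ≠ 0 := by
    rw [← hnz]
    exact exists_congr fun w => and_congr_right fun hw => by rw [eval m hw]
  ext C
  constructor
  · rintro ⟨Q, hQ, hw, rfl⟩
    obtain ⟨m, rfl⟩ := (Submodule.mem_span_range_iff_exists_fun ℂ).1 hQ
    exact ⟨_, _, (hex m).1 hw, hset m⟩
  · rintro ⟨α, β, hne, rfl⟩
    obtain ⟨r, s, hr, hs⟩ := exists_affine_eq h.ne (α / A) (β / B)
    rw [eq_div_iff hA] at hr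
    rw [eq_div_iff hB] at hs
    have e1 : A * ∑ k, ![r, s, 0] k * b ^ (k : ℕ) = α := by
      simp [Fin.sum_univ_three]; linear_combination hr
    have e2 : B * ∑ k, ![r, s, 0] k * c ^ (k : ℕ) = β := by
      simp [Fin.sum_univ_three]; linear_combination hs
    refine ⟨_, (Submodule.mem_span_range_iff_exists_fun ℂ).2 ⟨![r, s, 0], rfl⟩, ?_, ?_⟩
    · rwa [hex, e1, e2]
    · rw [hset, e1, e2]

/-- No line through the point lies in the three quadrics. -/
lemma not_liesOnLineIn (h : IsPolarPair a x b c) (ha : Function.Injective a)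
    (hy : y.submodule = ℂ ∙ x) : ¬ LiesOnLineIn (kummerSurface a) y := by
  rintro ⟨L, hL, hyL, hsub⟩
  have hx : x ∈ L := hyL (hy ▸ Submodule.mem_span_singleton_self x)
  have hq {w : HomCoord 5} (hw : w ∈ L) (k : Fin 3) : ∑ i, a i ^ (k : ℕ) * w i ^ 2 = 0 := by
    by_cases h0 : w = 0
    · simp [h0]
    · refine (mk_mem_kummerSurface a h0).1 (hsub _ ?_) k
      rwa [Projectivization.submodule_mk, Submodule.span_singleton_le_iff_mem]
  -- Polarization: the quadrics vanish at `x`, `w` and `x + w`, hence so do their bilinear forms at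
  -- the pair (x, w).
  have hT : L ≤ LinearMap.ker (jacobianMap a x) := by
    refine fun w hw => LinearMap.mem_ker.2 (funext fun k => ?_)
    have e : 2 * jacobianMap a x w k = ∑ i, a i ^ (k : ℕ) * (x + w) i ^ 2 -
        ∑ i, a i ^ (k : ℕ) * x i ^ 2 - ∑ i, a i ^ (k : ℕ) * w i ^ 2 := by
      rw [jacobianMap_apply, Finset.mul_sum, ← Finset.sum_sub_distrib, ← Finset.sum_sub_distrib]
      exact Finset.sum_congr rfl fun i _ => by simp only [Pi.add_apply]; ring
    rw [hq (add_mem hx hw), hq hx, hq hw] at e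
    simpa using e
  obtain ⟨v, hv, hne⟩ := h.exists_direction ha (y := y) ⟨L, hyL, hT, hL⟩
  have e0 := h.sum_mul_of_mem_ker ha (hT hv) (hT hv) 0
  have e1 := h.sum_mul_of_mem_ker ha (hT hv) (hT hv) 1
  simp only [← pow_two, hq hv] at e0 e1
  have hA := h.sum_sq_ne_zero ha
  have hB := h.symm.sum_sq_ne_zero ha
  have hbc := sub_ne_zero.2 h.ne
  simp only [Fin.val_zero, Fin.val_one, pow_zero, pow_one, mul_one] at e0 e1
  rcases hne with hne | hne
  · apply hne
    have : (b - c) * (∑ i, polarVec a x b i ^ 2) * h.leftCoord v ^ 2 = 0 := by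
      linear_combination c * e0 - e1
    simpa [hA, hbc] using this
  · apply hne
    have : (b - c) * (∑ i, polarVec a x c i ^ 2) * h.rightCoord v ^ 2 = 0 := by
      linear_combination e1 - b * e0
    simpa [hB, hbc] using this

variable {φ : (Fin 2 → ℂ) → HomCoord 5}

lemma hyperplaneSectionTangentCones_eq (h : IsPolarPair a (φ 0) b c) (ha : Function.Injective a)
    (hφ : IsLocalParametrization (kummerSurface a) y φ) :
    hyperplaneSectionTangentCones φ =
      {C | ∃ α β : ℂ, (α ≠ 0 ∨ β ≠ 0) ∧ C = h.tangentConic α β} := by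
  have hset {q : QuadraticForm ℂ (Fin 2 → ℂ)} {α β : ℂ}
      (hq : q = α • QuadraticMap.linMulLin h.leftTangent h.leftTangent +
        β • QuadraticMap.linMulLin h.rightTangent h.rightTangent) :
      {w | ∃ (z : ℂ) (u : Fin 2 → ℂ), q u = 0 ∧ w = z • φ 0 + fderiv ℂ φ 0 u} =
        h.tangentConic α β := by
    have hqu (u : Fin 2 → ℂ) : q u = α * h.leftTangent u ^ 2 + β * h.rightTangent u ^ 2 := by
      simp [hq, pow_two]
    have hc (z : ℂ) (u : Fin 2 → ℂ) : h.leftCoord (z • φ 0 + fderiv ℂ φ 0 u) = h.leftTangent u ∧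
        h.rightCoord (z • φ 0 + fderiv ℂ φ 0 u) = h.rightTangent u := by
      simp [h.leftCoord_self, h.rightCoord_self, leftTangent_apply, rightTangent_apply]
    ext w
    constructor
    · rintro ⟨z, u, hu, rfl⟩
      refine ⟨?_, ?_⟩
      · rw [← h.tangentPlaneCone_eq ha hφ]
        exact mem_tangentPlaneCone.2 ⟨z, u, rfl⟩
      · rw [(hc z u).1, (hc z u).2, ← hqu, hu]
    · rintro ⟨hw, e⟩
      rw [← h.tangentPlaneCone_eq ha hφ] at hw
      obtain ⟨z, u, rfl⟩ := mem_tangentPlaneCone.1 hw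
      refine ⟨z, u, ?_, rfl⟩
      rwa [hqu, ← (hc z u).1, ← (hc z u).2]
  ext C
  constructor
  · rintro ⟨q, hq, hne, rfl⟩
    rw [h.secondFundamentalSystem_eq ha hφ] at hq
    obtain ⟨α, β, hq⟩ := Submodule.mem_span_pair.1 hq
    refine ⟨α, β, ?_, hset hq.symm⟩
    by_contra! h0
    exact hne (by rw [← hq, h0.1, h0.2, zero_smul, zero_smul, add_zero])
  · rintro ⟨α, β, hne, rfl⟩
    refine ⟨_, ?_, ?_, (hset rfl).symm⟩
    · rw [h.secondFundamentalSystem_eq ha hφ]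
      exact Submodule.mem_span_pair.2 ⟨α, β, rfl⟩
    · intro h0
      obtain ⟨u₁, h11, h12⟩ := h.exists_tangent ha hφ 1 0
      obtain ⟨u₂, h21, h22⟩ := h.exists_tangent ha hφ 0 1
      have e1 := DFunLike.congr_fun h0 u₁
      have e2 := DFunLike.congr_fun h0 u₂
      rcases hne with hne | hne
      · exact hne (by simpa [h11, h12] using e1)
      · exact hne (by simpa [h21, h22] using e2)

/-- Both families of line pairs are the conics α X^2 + β Y^2 = 0, that is, the pairs of the
reflection. Uniqueness already follows from the condition on the sections by the net. -/
lemma existsUnique_involution (h : IsPolarPair a (φ 0) b c) (ha : Function.Injective a)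
    (hφ : IsLocalParametrization (kummerSurface a) y φ) :
    ∃! σ : LinePencil y (tangentPlaneCone φ) → LinePencil y (tangentPlaneCone φ),
      IsInvolution σ ∧
      planeSections (kummerNet a) (tangentPlaneCone φ) = involutionPairs σ ∧
      hyperplaneSectionTangentCones φ = involutionPairs σ := by
  rw [h.tangentPlaneCone_eq ha hφ, h.planeSections_eq ha, h.hyperplaneSectionTangentCones_eq ha hφ,
    ← h.involutionPairs_lineInvolution ha hφ.submodule_eq]
  refine ⟨_, ⟨h.isInvolution_lineInvolution ha hφ.submodule_eq, rfl, rfl⟩, fun τ hτ => ?_⟩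
  exact eq_of_involutionPairs_eq (h.lineInvolution_lineInvolution ha hφ.submodule_eq) hτ.2.1.symm

end IsPolarPair

/-! ### An explicit local parametrization -/

/-- The principal branch of the square root. -/
def csqrt (z : ℂ) : ℂ := Complex.exp (Complex.log z / 2)

lemma csqrt_sq {z : ℂ} (hz : z ≠ 0) : csqrt z ^ 2 = z := by
  rw [csqrt, ← Complex.exp_nat_mul]
  push_cast
  rw [mul_div_cancel₀ _ two_ne_zero, Complex.exp_log hz]

lemma csqrt_one : csqrt 1 = 1 := by simp [csqrt]

lemma analyticAt_csqrt_one : AnalyticAt ℂ csqrt 1 :=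
  ((analyticAt_clog Complex.one_mem_slitPlane).div_const).cexp

lemma hasDerivAt_csqrt_one : HasDerivAt csqrt (1 / 2) 1 := by
  have := ((Complex.hasDerivAt_log Complex.one_mem_slitPlane).div_const 2).cexp
  exact this.congr_deriv (by simp)

namespace IsPolarPair

variable {a x : Fin 6 → ℂ} {b c : ℂ} {y : ProjSpace 5}

/-- The differential of the quotient `x_i(t)^2 / x_i^2` along the standard parametrization. -/
def ratioForm (_ : IsPolarPair a x b c) (i : Fin 6) : (Fin 2 → ℂ) →L[ℂ] ℂ :=
  (a i - b)⁻¹ • ContinuousLinearMap.proj 0 + (a i - c)⁻¹ • ContinuousLinearMap.proj 1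

lemma ratioForm_apply (h : IsPolarPair a x b c) (i : Fin 6) (t : Fin 2 → ℂ) :
    h.ratioForm i t = (a i - b)⁻¹ * t 0 + (a i - c)⁻¹ * t 1 := rfl

/-- The standard parametrization of the surface near `x`. -/
def param (h : IsPolarPair a x b c) (t : Fin 2 → ℂ) : HomCoord 5 :=
  fun i => x i * csqrt (1 + h.ratioForm i t)

lemma param_zero (h : IsPolarPair a x b c) : h.param 0 = x := by
  ext i; simp [param, csqrt_one]

lemma analyticAt_param (h : IsPolarPair a x b c) : AnalyticAt ℂ h.param 0 := by
  refine analyticAt_pi_iff.2 fun i => analyticAt_const.mul ?_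
  refine AnalyticAt.fun_comp (g := csqrt) (f := fun t => 1 + h.ratioForm i t) ?_
    (analyticAt_const.add ((h.ratioForm i).analyticAt 0))
  simpa using analyticAt_csqrt_one

lemma fderiv_param (h : IsPolarPair a x b c) (u : Fin 2 → ℂ) (i : Fin 6) :
    fderiv ℂ h.param 0 u i = x i * (1 / 2 * h.ratioForm i u) := by
  have h1 : HasFDerivAt (fun t => h.param t i)
      (x i • ((1 / 2 : ℂ) • h.ratioForm i)) 0 := by
    refine HasFDerivAt.const_mul ?_ (x i)
    have hd : HasDerivAt csqrt (1 / 2) (1 + h.ratioForm i 0) := by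
      simpa using hasDerivAt_csqrt_one
    exact hd.comp_hasFDerivAt (f := fun t => 1 + h.ratioForm i t) 0 ((h.ratioForm i).hasFDerivAt.const_add 1)
  have h2 := hasFDerivAt_pi'.1 h.analyticAt_param.differentiableAt.hasFDerivAt i
  exact DFunLike.congr_fun (h2.unique h1) u

lemma param_sq (h : IsPolarPair a x b c) {t : Fin 2 → ℂ} {i : Fin 6}
    (ht : 1 + h.ratioForm i t ≠ 0) : h.param t i ^ 2 = x i ^ 2 * (1 + h.ratioForm i t) := by
  rw [param, mul_pow, csqrt_sq ht]

lemma eventually_ratio_ne_zero (h : IsPolarPair a x b c) :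
    ∀ᶠ t in 𝓝 0, ∀ i, 1 + h.ratioForm i t ≠ 0 := by
  refine Filter.eventually_all.2 fun i => ?_
  have : ContinuousAt (fun t => 1 + h.ratioForm i t) 0 := by fun_prop
  exact this.eventually_ne (by simp)

/-- The coefficient of `x` in a tangent vector. -/
def baseCoord (h : IsPolarPair a x b c) (v : HomCoord 5) : ℂ :=
  -- Since `x` is isotropic and orthogonal to the polar vectors, pairing with `x` cannot detect its
  -- coefficient; it is read off from coordinate 0 instead.
  v 0 / x 0 - h.leftCoord v / (a 0 - b) - h.rightCoord v / (a 0 - c)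

lemma eq_of_mem_ker (h : IsPolarPair a x b c) (ha : Function.Injective a) {v : HomCoord 5}
    (hv : v ∈ LinearMap.ker (jacobianMap a x)) :
    v = h.baseCoord v • x + h.leftCoord v • polarVec a x b + h.rightCoord v • polarVec a x c := by
  obtain ⟨z, hz⟩ := h.exists_eq_of_mem_ker ha hv
  have e : h.baseCoord v = z := by
    have h0 := congrFun hz 0
    simp only [Pi.add_apply, Pi.smul_apply, polarVec, smul_eq_mul] at h0
    have h1 := h.coord_ne 0
    have h2 := h.left_ne 0
    have h3 := h.right_ne 0
    rw [baseCoord, h0]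
    field_simp
    ring
  rw [e]
  exact hz

/-- A local inverse of the standard parametrization of the cone. -/
def paramInv (h : IsPolarPair a x b c) (w : HomCoord 5) : ℂ × (Fin 2 → ℂ) :=
  let v : HomCoord 5 := fun i => w i ^ 2 / x i
  (csqrt (h.baseCoord v), ![h.leftCoord v / h.baseCoord v, h.rightCoord v / h.baseCoord v])

lemma div_self_eq (h : IsPolarPair a x b c) : (fun i => x i ^ 2 / x i) = x := by
  ext i
  have := h.coord_ne i
  field_simp

lemma baseCoord_self (h : IsPolarPair a x b c) : h.baseCoord x = 1 := by
  simp [baseCoord, h.leftCoord_self, h.rightCoord_self, h.coord_ne 0]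

lemma paramInv_self (h : IsPolarPair a x b c) : h.paramInv x = (1, 0) := by
  simp [paramInv, h.div_self_eq, h.baseCoord_self, csqrt_one, h.leftCoord_self, h.rightCoord_self]

lemma continuousAt_paramInv (h : IsPolarPair a x b c) :
    ContinuousAt h.paramInv x ∧
      ContinuousAt (fun w : HomCoord 5 => h.baseCoord fun i => w i ^ 2 / x i) x := by
  have hv : Continuous fun w : HomCoord 5 => (fun i => w i ^ 2 / x i : HomCoord 5) := by fun_prop
  have hl : Continuous fun w : HomCoord 5 => h.leftCoord fun i => w i ^ 2 / x i :=
    h.leftCoord.continuous_of_finiteDimensional.comp hv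
  have hr : Continuous fun w : HomCoord 5 => h.rightCoord fun i => w i ^ 2 / x i :=
    h.rightCoord.continuous_of_finiteDimensional.comp hv
  have hb : Continuous fun w : HomCoord 5 => h.baseCoord fun i => w i ^ 2 / x i := by
    unfold baseCoord
    fun_prop
  have hb1 : (h.baseCoord fun i => x i ^ 2 / x i) = 1 := by rw [h.div_self_eq, h.baseCoord_self]
  refine ⟨ContinuousAt.prodMk ?_ (continuousAt_pi.2 fun j => ?_), hb.continuousAt⟩
  · refine ContinuousAt.comp' (g := csqrt) ?_ hb.continuousAt
    rw [hb1]
    exact analyticAt_csqrt_one.continuousAt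
  · fin_cases j
    · exact hl.continuousAt.div hb.continuousAt (by rw [hb1]; exact one_ne_zero)
    · exact hr.continuousAt.div hb.continuousAt (by rw [hb1]; exact one_ne_zero)

/-- The equations are linear in the squares: `w` satisfies them exactly when the vector with
coordinates w_i^2/x_i lies in the cone over the tangent plane. The parametrization takes
coordinatewise square roots of a linear parametrization, and expanding this vector in the polar
basis gives a continuous local inverse. -/
lemma map_nhds_param (h : IsPolarPair a x b c) (ha : Function.Injective a) :
    Filter.map (fun p : ℂ × (Fin 2 → ℂ) => p.1 • h.param p.2) (𝓝 (1, 0)) =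
      𝓝[puncturedCone (kummerSurface a)] x := by
  set ψ := fun p : ℂ × (Fin 2 → ℂ) => p.1 • h.param p.2 with hψ
  have hcont : ContinuousAt ψ (1, 0) :=
    continuousAt_fst.smul (ContinuousAt.comp' (g := h.param)
      h.analyticAt_param.continuousAt continuousAt_snd)
  have hψ1 : ψ (1, 0) = x := by simp [hψ, h.param_zero]
  apply le_antisymm
  · refine tendsto_nhdsWithin_iff.2 ⟨hψ1 ▸ hcont.tendsto, ?_⟩
    have hr : ∀ᶠ p : ℂ × (Fin 2 → ℂ) in 𝓝 (1, 0), ∀ i, 1 + h.ratioForm i p.2 ≠ 0 :=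
      (continuousAt_snd (p := ((1 : ℂ), (0 : Fin 2 → ℂ)))).tendsto.eventually
        h.eventually_ratio_ne_zero
    filter_upwards [hr, hcont.eventually_ne (hψ1.trans_ne h.ne_zero)] with p hp hne
    refine (mem_puncturedCone_kummerSurface a).2 ⟨hne, fun k => ?_⟩
    have e : ∑ i, a i ^ (k : ℕ) * ψ p i ^ 2 = p.1 ^ 2 * (∑ i, a i ^ (k : ℕ) * x i ^ 2 +
        p.2 0 * ∑ i, a i ^ (k : ℕ) * x i * polarVec a x b i +
        p.2 1 * ∑ i, a i ^ (k : ℕ) * x i * polarVec a x c i) := by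
      simp only [Finset.mul_sum, ← Finset.sum_add_distrib]
      refine Finset.sum_congr rfl fun i _ => ?_
      simp only [hψ, Pi.smul_apply, smul_eq_mul, mul_pow, h.param_sq (hp i), ratioForm_apply,
        polarVec]
      ring
    rw [e, h.moment, h.sum_left, h.symm.sum_left]
    simp
  · obtain ⟨hg, hb⟩ := h.continuousAt_paramInv
    have hψg : ContinuousAt (fun w => ψ (h.paramInv w)) x :=
      ContinuousAt.comp' (g := ψ) (by rw [h.paramInv_self]; exact hcont) hg
    have hψx : ψ (h.paramInv x) = x := by rw [h.paramInv_self, hψ1]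
    have hright : ∀ᶠ w in 𝓝[puncturedCone (kummerSurface a)] x, ψ (h.paramInv w) = w := by
      have h1 : ∀ᶠ w in 𝓝 x, (h.baseCoord fun i => w i ^ 2 / x i) ≠ 0 :=
        hb.eventually_ne (by rw [h.div_self_eq, h.baseCoord_self]; exact one_ne_zero)
      have h2 : ∀ᶠ w in 𝓝 x, ∀ i, 1 + h.ratioForm i (h.paramInv w).2 ≠ 0 := by
        refine hg.snd.tendsto.eventually (p := fun t => ∀ i, 1 + h.ratioForm i t ≠ 0) ?_
        rw [h.paramInv_self]
        exact h.eventually_ratio_ne_zero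
      -- The inverse is at first checked only on squares; this excludes the wrong sign, both
      -- quantities being close to `x i ≠ 0`.
      have h3 : ∀ᶠ w in 𝓝 x, ∀ i, ψ (h.paramInv w) i + w i ≠ 0 := by
        refine Filter.eventually_all.2 fun i => ?_
        refine ContinuousAt.eventually_ne (((continuousAt_pi.1 hψg) i).add
          (continuous_apply i).continuousAt) ?_
        rw [hψx, ← two_mul]
        exact mul_ne_zero two_ne_zero (h.coord_ne i)
      filter_upwards [h1.filter_mono nhdsWithin_le_nhds, h2.filter_mono nhdsWithin_le_nhds,
        h3.filter_mono nhdsWithin_le_nhds, self_mem_nhdsWithin] with w hz hr hs hw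
      have hw := ((mem_puncturedCone_kummerSurface a).1 hw).2
      set v : HomCoord 5 := fun i => w i ^ 2 / x i with hv
      have hvker : v ∈ LinearMap.ker (jacobianMap a x) := by
        refine LinearMap.mem_ker.2 (funext fun k => ?_)
        refine Eq.trans ?_ (hw k)
        rw [jacobianMap_apply]
        refine Finset.sum_congr rfl fun i _ => ?_
        have := h.coord_ne i
        simp only [hv]
        field_simp
      ext i
      have hvi := congrFun (h.eq_of_mem_ker ha hvker) i
      have hx := h.coord_ne i
      have hsq : ψ (h.paramInv w) i ^ 2 = w i ^ 2 := by
        have e1 : w i ^ 2 = x i * v i := by simp only [hv]; field_simp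
        have e2 : (h.paramInv w).1 = csqrt (h.baseCoord v) := rfl
        have e3 : (h.paramInv w).2 0 = h.leftCoord v / h.baseCoord v := rfl
        have e4 : (h.paramInv w).2 1 = h.rightCoord v / h.baseCoord v := rfl
        rw [e1, hvi]
        simp only [hψ, Pi.smul_apply, Pi.add_apply, smul_eq_mul, mul_pow, h.param_sq (hr i), e2,
          csqrt_sq hz, ratioForm_apply, e3, e4, polarVec]
        field_simp
        ring
      exact ((sq_eq_sq_iff_eq_or_eq_neg.1 hsq).resolve_right fun e => hs i (by rw [e]; ring))
    have hg' : Filter.Tendsto h.paramInv (𝓝[puncturedCone (kummerSurface a)] x) (𝓝 (1, 0)) := by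
      rw [← h.paramInv_self]
      exact hg.tendsto.mono_left nhdsWithin_le_nhds
    calc 𝓝[puncturedCone (kummerSurface a)] x
        = Filter.map (fun w => ψ (h.paramInv w)) (𝓝[puncturedCone (kummerSurface a)] x) := by
          rw [Filter.map_congr hright, Filter.map_id']
      _ ≤ Filter.map ψ (𝓝 (1, 0)) := by
          rw [← Function.comp_def ψ, ← Filter.map_map]
          exact Filter.map_mono hg'

lemma isLocalParametrization_param (h : IsPolarPair a x b c) (ha : Function.Injective a)
    (hy : y.submodule = ℂ ∙ x) : IsLocalParametrization (kummerSurface a) y h.param where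
  analyticAt := h.analyticAt_param
  base := by
    rw [h.param_zero, hy]
    exact Submodule.mem_span_singleton_self x
  immersive := by
    have h1 : fderiv ℂ h.param 0 (Pi.single 0 1) = (1 / 2 : ℂ) • polarVec a x b := by
      ext i
      rw [h.fderiv_param, ratioForm_apply]
      simp [polarVec]
      ring
    have h2 : fderiv ℂ h.param 0 (Pi.single 1 1) = (1 / 2 : ℂ) • polarVec a x c := by
      ext i
      rw [h.fderiv_param, ratioForm_apply]
      simp [polarVec]
      ring
    rw [h1, h2, h.param_zero, Fintype.linearIndependent_iff]
    intro g hg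
    simp only [Fin.sum_univ_three, Matrix.cons_val, smul_smul] at hg
    have := Fintype.linearIndependent_iff.1 (h.linearIndependent ha)
      ![g 0, g 1 * (1 / 2), g 2 * (1 / 2)] (by simpa [Fin.sum_univ_three] using hg)
    intro i
    fin_cases i
    · simpa using this 0
    · simpa using this 1
    · simpa using this 2
  map_nhds := by rw [h.map_nhds_param ha, h.param_zero]

end IsPolarPair

/-! ### The two zeros of the polar function -/

/-- The polynomial with roots the six parameters. -/
abbrev nodePoly (a : Fin 6 → ℂ) : Polynomial ℂ := Lagrange.nodal Finset.univ a

/-- The sum `∑ a_i^k w_i`. -/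
def nodeMoment (a : Fin 6 → ℂ) (k : ℕ) (w : Fin 6 → ℂ) : ℂ := ∑ i, a i ^ k * w i

/-- The discriminant of the quadratic polynomial `∏ (t - a_i) * ∑ w_i / (t - a_i)`, where the
moments of `w` of order less than three vanish. -/
def polarDiscrim (a w : Fin 6 → ℂ) : ℂ :=
  discrim (nodeMoment a 3 w) (nodeMoment a 4 w + (nodePoly a).coeff 5 * nodeMoment a 3 w)
    (nodeMoment a 5 w + (nodePoly a).coeff 5 * nodeMoment a 4 w +
      (nodePoly a).coeff 4 * nodeMoment a 3 w)

lemma nodePoly_eq (a : Fin 6 → ℂ) : ∃ c₀ c₁ c₂ c₃ : ℂ, nodePoly a =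
    .X ^ 6 + .C ((nodePoly a).coeff 5) * .X ^ 5 + .C ((nodePoly a).coeff 4) * .X ^ 4 +
      .C c₃ * .X ^ 3 + .C c₂ * .X ^ 2 + .C c₁ * .X + .C c₀ := by
  have hdeg : (nodePoly a).natDegree = 6 := by simp [nodePoly]
  have hmon : (nodePoly a).coeff 6 = 1 := by
    rw [← hdeg]
    exact Lagrange.nodal_monic
  refine ⟨(nodePoly a).coeff 0, (nodePoly a).coeff 1, (nodePoly a).coeff 2,
    (nodePoly a).coeff 3, ?_⟩
  conv_lhs => rw [(nodePoly a).as_sum_range_C_mul_X_pow, hdeg]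
  simp only [Finset.sum_range_succ, Finset.sum_range_zero, hmon, map_one]
  ring

/-- The left side is, up to sign, the numerator of ∑ w_i/(a_i - t). The quotient of the node
polynomial by t - a_i has coefficients polynomial in a_i (Horner's scheme), so the sum is a
combination of moments, and only orders 3, 4, 5 remain. -/
lemma sum_mul_eval_nodal_erase (a : Fin 6 → ℂ) {w : Fin 6 → ℂ}
    (hw : ∀ k < 3, nodeMoment a k w = 0) (t : ℂ) :
    ∑ i, w i * (Lagrange.nodal (Finset.univ.erase i) a).eval t =
      nodeMoment a 3 w * (t * t) +
      (nodeMoment a 4 w + (nodePoly a).coeff 5 * nodeMoment a 3 w) * t +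
      (nodeMoment a 5 w + (nodePoly a).coeff 5 * nodeMoment a 4 w +
      (nodePoly a).coeff 4 * nodeMoment a 3 w) := by
  obtain ⟨c₀, c₁, c₂, c₃, hf⟩ := nodePoly_eq a
  set c₄ := (nodePoly a).coeff 4
  set c₅ := (nodePoly a).coeff 5
  have key (i : Fin 6) : Lagrange.nodal (Finset.univ.erase i) a =
      .X ^ 5 + .C (a i + c₅) * .X ^ 4 + .C (a i ^ 2 + c₅ * a i + c₄) * .X ^ 3 +
      .C (a i ^ 3 + c₅ * a i ^ 2 + c₄ * a i + c₃) * .X ^ 2 +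
      .C (a i ^ 4 + c₅ * a i ^ 3 + c₄ * a i ^ 2 + c₃ * a i + c₂) * .X +
      .C (a i ^ 5 + c₅ * a i ^ 4 + c₄ * a i ^ 3 + c₃ * a i ^ 2 + c₂ * a i + c₁) := by
    refine mul_left_cancel₀ (Polynomial.X_sub_C_ne_zero (a i)) ?_
    rw [← Lagrange.nodal_eq_mul_nodal_erase (Finset.mem_univ i)]
    have h0 : (nodePoly a).eval (a i) = 0 := Lagrange.eval_nodal_at_node (Finset.mem_univ i)
    rw [hf] at h0
    simp only [Polynomial.eval_add, Polynomial.eval_mul, Polynomial.eval_pow, Polynomial.eval_X,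
      Polynomial.eval_C] at h0
    have h1 := congrArg (Polynomial.C : ℂ → Polynomial ℂ) h0
    change nodePoly a = _
    rw [hf]
    simp only [map_add, map_mul, map_pow, map_zero] at h1 ⊢
    linear_combination h1
  have h0 := hw 0 (by norm_num)
  have h1 := hw 1 (by norm_num)
  have h2 := hw 2 (by norm_num)
  have e : ∑ i, w i * (Lagrange.nodal (Finset.univ.erase i) a).eval t =
      nodeMoment a 5 w + (t + c₅) * nodeMoment a 4 w +
      (t ^ 2 + c₅ * t + c₄) * nodeMoment a 3 w +
      (t ^ 3 + c₅ * t ^ 2 + c₄ * t + c₃) * nodeMoment a 2 w +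
      (t ^ 4 + c₅ * t ^ 3 + c₄ * t ^ 2 + c₃ * t + c₂) * nodeMoment a 1 w +
      (t ^ 5 + c₅ * t ^ 4 + c₄ * t ^ 3 + c₃ * t ^ 2 + c₂ * t + c₁) * nodeMoment a 0 w := by
    simp only [nodeMoment, Finset.mul_sum, ← Finset.sum_add_distrib]
    refine Finset.sum_congr rfl fun i _ => ?_
    rw [key i]
    simp only [Polynomial.eval_add, Polynomial.eval_mul, Polynomial.eval_pow, Polynomial.eval_X,
      Polynomial.eval_C]
    ring
  rw [e, h0, h1, h2]
  ring

/-- At a node the numerator reduces to w_i ∏ (a_i - a_j) ≠ 0, so its zeros avoid the nodes and are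
zeros of the rational function. -/
lemma sum_div_eq_zero {a w : Fin 6 → ℂ} (ha : Function.Injective a) (hw0 : ∀ i, w i ≠ 0) {t : ℂ}
    (ht : ∑ i, w i * (Lagrange.nodal (Finset.univ.erase i) a).eval t = 0) :
    (∀ i, a i - t ≠ 0) ∧ ∑ i, w i / (a i - t) = 0 := by
  have hne (i : Fin 6) : a i - t ≠ 0 := by
    intro hi
    obtain rfl : a i = t := sub_eq_zero.1 hi
    rw [Finset.sum_eq_single i] at ht
    · refine (mul_ne_zero (hw0 i) ?_) ht
      rw [Lagrange.eval_nodal, Finset.prod_ne_zero_iff]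
      exact fun j hj => sub_ne_zero.2 fun e => Finset.ne_of_mem_erase hj (ha e.symm)
    · intro j _ hj
      rw [Lagrange.eval_nodal_at_node (Finset.mem_erase.2 ⟨hj.symm, Finset.mem_univ _⟩), mul_zero]
    · simp
  refine ⟨hne, ?_⟩
  have hf : (nodePoly a).eval t ≠ 0 := by
    rw [Lagrange.eval_nodal, Finset.prod_ne_zero_iff]
    exact fun j _ => sub_ne_zero.2 fun e => hne j (sub_eq_zero.2 e.symm)
  have e : -(nodePoly a).eval t * ∑ i, w i / (a i - t) = 0 := by
    rw [← ht, Finset.mul_sum]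
    refine Finset.sum_congr rfl fun i _ => ?_
    have h1 := hne i
    rw [nodePoly, Lagrange.nodal_eq_mul_nodal_erase (Finset.mem_univ i)]
    simp only [Polynomial.eval_mul, Polynomial.eval_sub, Polynomial.eval_X, Polynomial.eval_C]
    field_simp
    ring
  exact (mul_eq_zero.1 e).resolve_left (neg_ne_zero.2 hf)

lemma exists_isPolarPair {a x : Fin 6 → ℂ} (ha : Function.Injective a)
    (hx : ∀ k : Fin 3, ∑ i, a i ^ (k : ℕ) * x i ^ 2 = 0) (h0 : ∀ i, x i ≠ 0)
    (h3 : nodeMoment a 3 (fun i => x i ^ 2) ≠ 0) (hd : polarDiscrim a (fun i => x i ^ 2) ≠ 0) :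
    ∃ b c, IsPolarPair a x b c := by
  obtain ⟨s, hs⟩ := IsAlgClosed.exists_eq_mul_self (polarDiscrim a fun i => x i ^ 2)
  have hs0 : s ≠ 0 := by rintro rfl; exact hd (by simpa using hs)
  set p := nodeMoment a 3 fun i => x i ^ 2
  set q := nodeMoment a 4 (fun i => x i ^ 2) + (nodePoly a).coeff 5 * p
  have hsum (t : ℂ) (ht : t = (-q + s) / (2 * p) ∨ t = (-q - s) / (2 * p)) :=
    sum_div_eq_zero (a := a) (w := fun i => x i ^ 2) ha (fun i => pow_ne_zero 2 (h0 i))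
      ((sum_mul_eval_nodal_erase a (fun k hk => hx ⟨k, hk⟩) t).trans
        ((quadratic_eq_zero_iff h3 hs t).2 ht))
  obtain ⟨hb, hb'⟩ := hsum _ (Or.inl rfl)
  obtain ⟨hc, hc'⟩ := hsum _ (Or.inr rfl)
  refine ⟨_, _, h0, hx, ?_, hb, hc, hb', hc'⟩
  intro e
  field_simp at e
  have : 2 * s = 0 := by linear_combination e
  simp [hs0] at this

/-- A vector of squares with vanishing moments for which the discriminant does not vanish. -/
lemma exists_general_direction {a : Fin 6 → ℂ} (ha : Function.Injective a) :
    ∃ w : Fin 6 → ℂ, (∀ i, w i ≠ 0) ∧ (∀ k < 3, nodeMoment a k w = 0) ∧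
      nodeMoment a 3 w ≠ 0 ∧ polarDiscrim a w ≠ 0 := by
  obtain ⟨b, hb⟩ := Infinite.exists_notMem_finset (Finset.univ.image a)
  obtain ⟨c, hc⟩ := Infinite.exists_notMem_finset (insert b (Finset.univ.image a))
  simp only [Finset.mem_insert, Finset.mem_image, Finset.mem_univ, true_and, not_or, not_exists]
    at hb hc
  obtain ⟨hcb, hc⟩ := hc
  have hbi (i : Fin 6) : a i - b ≠ 0 := sub_ne_zero.2 (hb i)
  have hci (i : Fin 6) : a i - c ≠ 0 := sub_ne_zero.2 (hc i)
  have hD (i : Fin 6) : ∏ j ∈ Finset.univ.erase i, (a i - a j) ≠ 0 := by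
    rw [Finset.prod_ne_zero_iff]
    exact fun j hj => sub_ne_zero.2 fun e => Finset.ne_of_mem_erase hj (ha e.symm)
  -- The leading coefficient in Lagrange interpolation. Weights r(a_i)/∏ (a_i - a_j) therefore have
  -- as k-th moment, for k ≤ 3, the coefficient of t^5 in t^k r, and with deg r = 2 the first three
  -- vanish. The prescribed roots b, c of r become the zeros of the numerator.
  have hsum (P : Polynomial ℂ) (hP : P.natDegree < 6) :
      P.coeff 5 = ∑ i, P.eval (a i) / ∏ j ∈ Finset.univ.erase i, (a i - a j) :=
    Lagrange.coeff_eq_sum (s := Finset.univ) (v := a) ha.injOn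
      (Polynomial.degree_le_natDegree.trans_lt (by simpa using hP))
  set r : Polynomial ℂ := (.X - .C b) * (.X - .C c) with hr
  have hrm : r.Monic := (Polynomial.monic_X_sub_C b).mul (Polynomial.monic_X_sub_C c)
  have hrdeg : r.natDegree = 2 := by
    rw [hr, (Polynomial.monic_X_sub_C b).natDegree_mul (Polynomial.monic_X_sub_C c)]
    simp
  set w : Fin 6 → ℂ := fun i => r.eval (a i) / ∏ j ∈ Finset.univ.erase i, (a i - a j) with hw
  have hmom (k : ℕ) (hk : k ≤ 3) : nodeMoment a k w = (Polynomial.X ^ k * r).coeff 5 := by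
    rw [hsum _ ((Polynomial.natDegree_mul_le).trans_lt (by
      rw [hrdeg, Polynomial.natDegree_X_pow]; omega))]
    refine Finset.sum_congr rfl fun i _ => ?_
    simp only [hw, Polynomial.eval_mul, Polynomial.eval_pow, Polynomial.eval_X]
    ring
  have hlow : ∀ k < 3, nodeMoment a k w = 0 := fun k hk => by
    rw [hmom k hk.le, Polynomial.coeff_X_pow_mul', if_pos (by omega)]
    exact Polynomial.coeff_eq_zero_of_natDegree_lt (by omega)
  have h3 : nodeMoment a 3 w = 1 := by
    rw [hmom 3 le_rfl, Polynomial.coeff_X_pow_mul', if_pos (by omega)]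
    have := hrm.coeff_natDegree
    rwa [hrdeg] at this
  have hroot (t s : ℂ) (hts : ∀ z, r.eval z = (z - t) * (z - s)) :
      ∑ i, w i * (Lagrange.nodal (Finset.univ.erase i) a).eval t = 0 := by
    -- At the root t of r the numerator equals -∏ (t - a_j) times ∑ (a_i - s)/∏ (a_i - a_j), which
    -- vanishes because X - s has no term of degree 5.
    have e := hsum (.X - .C s) (by simp)
    rw [Polynomial.coeff_eq_zero_of_natDegree_lt (by simp)] at e
    rw [← mul_zero (-(nodePoly a).eval t), e, Finset.mul_sum]
    refine Finset.sum_congr rfl fun i _ => ?_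
    rw [nodePoly, Lagrange.nodal_eq_mul_nodal_erase (Finset.mem_univ i)]
    simp only [hw, hts, Polynomial.eval_mul, Polynomial.eval_sub, Polynomial.eval_X,
      Polynomial.eval_C]
    ring
  have eb := hroot b c (fun z => by simp [hr])
  have ec := hroot c b (fun z => by simp [hr, mul_comm])
  rw [sum_mul_eval_nodal_erase a hlow] at eb ec
  refine ⟨w, fun i => div_ne_zero ?_ (hD i), hlow, by rw [h3]; exact one_ne_zero, ?_⟩
  · simp [hr, hbi i, hci i]
  · rw [polarDiscrim]
    set q := nodeMoment a 4 w + (nodePoly a).coeff 5 * nodeMoment a 3 w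
    set d := nodeMoment a 5 w + (nodePoly a).coeff 5 * nodeMoment a 4 w +
      (nodePoly a).coeff 4 * nodeMoment a 3 w
    rw [h3] at eb ec ⊢
    have hbc : c - b ≠ 0 := sub_ne_zero.2 hcb
    have hq : q = -(b + c) := by
      have : (c - b) * (q + b + c) = 0 := by linear_combination ec - eb
      linear_combination (mul_eq_zero.1 this).resolve_left hbc
    have : discrim 1 q d = (c - b) ^ 2 := by
      rw [discrim]
      linear_combination (q + b + c) * hq - 4 * eb + 4 * b * hq - 2 * (b + c) * hq
    rw [this]
    exact pow_ne_zero 2 hbc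

/-! ### General points of the Kummer surface -/

lemma eval_smul_of_isHomogeneous {σ : Type*} {F : MvPolynomial σ ℂ} {d : ℕ}
    (hF : F.IsHomogeneous d) (s : ℂ) (v : σ → ℂ) :
    MvPolynomial.eval (s • v) F = s ^ d * MvPolynomial.eval v F := by
  rw [MvPolynomial.eval_eq, MvPolynomial.eval_eq, Finset.mul_sum]
  refine Finset.sum_congr rfl fun m hm => ?_
  have hd : ∑ i ∈ m.support, m i = d := by
    rw [← Finsupp.degree_apply]
    by_contra hne
    exact MvPolynomial.mem_support_iff.1 hm (hF.coeff_eq_zero hne)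
  simp only [Pi.smul_apply, smul_eq_mul, mul_pow, Finset.prod_mul_distrib]
  rw [Finset.prod_pow_eq_pow_sum, hd]
  ring

lemma eval_rep_mk_eq_zero_iff {N : ℕ} {F : MvPolynomial (Fin (N + 1)) ℂ} {d : ℕ}
    (hF : F.IsHomogeneous d) {v : HomCoord N} (hv : v ≠ 0) :
    MvPolynomial.eval (Projectivization.mk ℂ v hv).rep F = 0 ↔ MvPolynomial.eval v F = 0 := by
  obtain ⟨s, hs⟩ := Projectivization.exists_smul_eq_mk_rep ℂ v hv
  rw [← hs, Units.smul_def, eval_smul_of_isHomogeneous hF]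
  simp

/-- The quadratic form `∑ a_i^k x_i^2` as a polynomial. -/
def momentPoly (a : Fin 6 → ℂ) (k : ℕ) : MvPolynomial (Fin 6) ℂ :=
  ∑ i, .C (a i ^ k) * .X i ^ 2

lemma isHomogeneous_momentPoly (a : Fin 6 → ℂ) (k : ℕ) : (momentPoly a k).IsHomogeneous 2 :=
  .sum _ _ _ fun i _ => MvPolynomial.isHomogeneous_C_mul_X_pow _ i 2

lemma eval_momentPoly (a x : Fin 6 → ℂ) (k : ℕ) :
    MvPolynomial.eval x (momentPoly a k) = nodeMoment a k fun i => x i ^ 2 := by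
  simp [momentPoly, nodeMoment]

/-- The equation of the complement of the set of general points. -/
def degeneracyPoly (a : Fin 6 → ℂ) : MvPolynomial (Fin 6) ℂ :=
  (∏ i, .X i) * momentPoly a 3 *
    ((momentPoly a 4 + .C ((nodePoly a).coeff 5) * momentPoly a 3) ^ 2 -
      .C 4 * momentPoly a 3 * (momentPoly a 5 + .C ((nodePoly a).coeff 5) * momentPoly a 4 +
        .C ((nodePoly a).coeff 4) * momentPoly a 3))

lemma isHomogeneous_degeneracyPoly (a : Fin 6 → ℂ) :
    ∃ d, (degeneracyPoly a).IsHomogeneous d := by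
  have hm := isHomogeneous_momentPoly a
  refine ⟨_, ((MvPolynomial.IsHomogeneous.prod _ _ _ fun i _ =>
    MvPolynomial.isHomogeneous_X ℂ i).mul (hm 3)).mul (n := 4) (.sub ?_ ?_)⟩
  · exact ((hm 4).add ((hm 3).C_mul _)).pow 2
  · exact ((hm 3).C_mul _).mul (((hm 5).add ((hm 4).C_mul _)).add ((hm 3).C_mul _))

lemma eval_degeneracyPoly (a x : Fin 6 → ℂ) :
    MvPolynomial.eval x (degeneracyPoly a) =
      (∏ i, x i) * nodeMoment a 3 (fun i => x i ^ 2) * polarDiscrim a fun i => x i ^ 2 := by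
  simp only [degeneracyPoly, map_mul, map_prod, map_sub, map_pow, map_add, eval_momentPoly,
    MvPolynomial.eval_X, MvPolynomial.eval_C, polarDiscrim, discrim]

/-- The complement of the set of general points. -/
def degeneracyLocus (a : Fin 6 → ℂ) : Set (ProjSpace 5) :=
  {x | ∀ F ∈ ({degeneracyPoly a} : Set (MvPolynomial (Fin 6) ℂ)), MvPolynomial.eval x.rep F = 0}

lemma isZariskiClosed_degeneracyLocus (a : Fin 6 → ℂ) : IsZariskiClosed (degeneracyLocus a) :=
  ⟨{degeneracyPoly a}, fun _ hF => hF ▸ isHomogeneous_degeneracyPoly a, rfl⟩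

/-- A nonzero polynomial has finitely many zeros. `A` may vanish, since the point to be perturbed
may be degenerate. -/
lemma eventually_quadratic_ne_zero (A : ℂ) {B C : ℂ} (h : B ≠ 0 ∨ C ≠ 0) :
    ∀ᶠ s in 𝓝[≠] (0 : ℂ), A + s * B + s ^ 2 * C ≠ 0 := by
  set P : Polynomial ℂ := .C C * .X ^ 2 + .C B * .X + .C A with hP
  have hP0 : P ≠ 0 := by
    intro h0
    have h1 := congrArg (fun Q => Polynomial.coeff Q 1) h0
    have h2 := congrArg (fun Q => Polynomial.coeff Q 2) h0
    simp [hP, Polynomial.coeff_C] at h1 h2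
    rcases h with h | h <;> contradiction
  have hfin : {s | P.eval s = 0}.Finite := by
    refine P.roots.toFinset.finite_toSet.subset fun s hs => ?_
    simpa [hP0] using hs
  have := hfin.eventually_cofinite_notMem.filter_mono (Filter.le_cofinite_iff_compl_singleton_mem.2
    fun s => ?_ : 𝓝[≠] (0 : ℂ) ≤ Filter.cofinite)
  · filter_upwards [this] with s hs h0
    apply hs
    simp only [hP, Polynomial.eval_add, Polynomial.eval_mul, Polynomial.eval_pow,
      Polynomial.eval_X, Polynomial.eval_C]
    linear_combination h0
  · rcases eq_or_ne s 0 with rfl | hs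
    · exact self_mem_nhdsWithin
    · exact nhdsWithin_le_nhds (isOpen_compl_singleton.mem_nhds hs.symm)

lemma nodeMoment_add_smul (a w w' : Fin 6 → ℂ) (k : ℕ) (s : ℂ) :
    nodeMoment a k (fun i => w i + s * w' i) = nodeMoment a k w + s * nodeMoment a k w' := by
  simp only [nodeMoment, Finset.mul_sum, ← Finset.sum_add_distrib]
  exact Finset.sum_congr rfl fun i _ => by ring

/-- A square root of `z` near a square root of a nearby number. -/
lemma exists_sq_eq_norm_sub_sq_le (x z : ℂ) : ∃ y, y ^ 2 = z ∧ ‖y - x‖ ^ 2 ≤ ‖z - x ^ 2‖ := by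
  obtain ⟨y, hy⟩ := IsSquare.exists_sq z (IsAlgClosed.exists_eq_mul_self z)
  have e : z - x ^ 2 = (y - x) * (y + x) := by rw [hy]; ring
  -- The square of the smaller factor of z - x^2 = (y - x)(y + x) is bounded by the product; this
  -- also covers x = 0.
  rcases le_total ‖y - x‖ ‖y + x‖ with h | h
  · refine ⟨y, hy.symm, ?_⟩
    rw [e, norm_mul, pow_two]
    gcongr
  · refine ⟨-y, by rw [neg_sq, hy], ?_⟩
    have : ‖-y - x‖ = ‖y + x‖ := by rw [← norm_neg]; congr 1; ring
    rw [e, norm_mul, pow_two, this]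
    gcongr

/-- Every point of the cone is a limit of general points. -/
lemma mem_closure_general {a : Fin 6 → ℂ} (ha : Function.Injective a) {x : HomCoord 5}
    (hx : ∀ k : Fin 3, ∑ i, a i ^ (k : ℕ) * x i ^ 2 = 0) :
    x ∈ closure {y : HomCoord 5 | (∀ k : Fin 3, ∑ i, a i ^ (k : ℕ) * y i ^ 2 = 0) ∧
      MvPolynomial.eval y (degeneracyPoly a) ≠ 0} := by
  obtain ⟨w, hw0, hwm, hw3, hwd⟩ := exists_general_direction ha
  rw [Metric.mem_closure_iff]
  intro ε hε
  have h1 : ∀ᶠ s in 𝓝[≠] (0 : ℂ), ∀ i, x i ^ 2 + s * w i ≠ 0 := by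
    refine Filter.eventually_all.2 fun i => ?_
    simpa using eventually_quadratic_ne_zero (x i ^ 2) (C := 0) (Or.inl (hw0 i))
  have h2 : ∀ᶠ s in 𝓝[≠] (0 : ℂ), nodeMoment a 3 (fun i => x i ^ 2 + s * w i) ≠ 0 := by
    simp only [nodeMoment_add_smul a (fun i => x i ^ 2)]
    simpa using eventually_quadratic_ne_zero (nodeMoment a 3 fun i => x i ^ 2) (C := 0) (Or.inl hw3)
  have h3 : ∀ᶠ s in 𝓝[≠] (0 : ℂ), polarDiscrim a (fun i => x i ^ 2 + s * w i) ≠ 0 := by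
    set m := fun k => nodeMoment a k fun i => x i ^ 2 with hm
    set n := fun k => nodeMoment a k w with hn
    set c₄ := (nodePoly a).coeff 4 with h4
    set c₅ := (nodePoly a).coeff 5 with h5
    -- Along the perturbation the discriminant is quadratic in s, with leading coefficient
    -- `polarDiscrim a w ≠ 0`.
    refine (eventually_quadratic_ne_zero (polarDiscrim a fun i => x i ^ 2)
      (B := 2 * (m 4 + c₅ * m 3) * (n 4 + c₅ * n 3) - 4 * m 3 * (n 5 + c₅ * n 4 + c₄ * n 3) -
        4 * n 3 * (m 5 + c₅ * m 4 + c₄ * m 3)) (Or.inr hwd)).mono fun s hs => ?_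
    refine ne_of_eq_of_ne ?_ hs
    simp only [polarDiscrim, discrim, nodeMoment_add_smul a (fun i => x i ^ 2), hm, hn, ← h4, ← h5]
    ring
  have h4 : ∀ᶠ s in 𝓝[≠] (0 : ℂ), ∀ i, ‖s * w i‖ < ε ^ 2 := by
    refine Filter.Eventually.filter_mono nhdsWithin_le_nhds (Filter.eventually_all.2 fun i => ?_)
    have : ContinuousAt (fun s : ℂ => ‖s * w i‖) 0 := by fun_prop
    exact this.eventually_lt continuousAt_const (by simpa using pow_pos hε 2)
  obtain ⟨s, h1, h2, h3, h4⟩ := (h1.and (h2.and (h3.and h4))).exists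
  choose y hy hyx using fun i => exists_sq_eq_norm_sub_sq_le (x i) (x i ^ 2 + s * w i)
  refine ⟨y, ⟨fun k => ?_, ?_⟩, ?_⟩
  · simp only [hy]
    have := nodeMoment_add_smul a (fun i => x i ^ 2) w k s
    rw [hwm k k.2, mul_zero, add_zero] at this
    exact this.trans (hx k)
  · rw [eval_degeneracyPoly]
    simp only [hy]
    refine mul_ne_zero (mul_ne_zero (Finset.prod_ne_zero_iff.2 fun i _ h0 => ?_) h2) h3
    exact h1 i (by rw [← hy i, h0, zero_pow two_ne_zero])
  · rw [dist_comm, dist_pi_lt_iff hε]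
    intro i
    rw [dist_eq_norm]
    refine lt_of_pow_lt_pow_left₀ 2 hε.le ((hyx i).trans_lt ?_)
    simpa using h4 i

lemma degeneracyPoly_eval_zero (a : Fin 6 → ℂ) :
    MvPolynomial.eval (0 : Fin 6 → ℂ) (degeneracyPoly a) = 0 := by
  rw [eval_degeneracyPoly, Finset.prod_eq_zero (Finset.mem_univ 0) rfl, zero_mul, zero_mul]

lemma mk_mem_diff_degeneracyLocus {a : Fin 6 → ℂ} {y : HomCoord 5}
    (hy : ∀ k : Fin 3, ∑ i, a i ^ (k : ℕ) * y i ^ 2 = 0)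
    (hd : MvPolynomial.eval y (degeneracyPoly a) ≠ 0) :
    ∃ h0 : y ≠ 0, Projectivization.mk ℂ y h0 ∈ kummerSurface a \ degeneracyLocus a := by
  have h0 : y ≠ 0 := by rintro rfl; exact hd (degeneracyPoly_eval_zero a)
  refine ⟨h0, (mk_mem_kummerSurface a h0).2 hy, fun hZ => hd ?_⟩
  obtain ⟨d, hhom⟩ := isHomogeneous_degeneracyPoly a
  exact (eval_rep_mk_eq_zero_iff hhom h0).1 (hZ _ rfl)

/-- Zero sets of polynomials are closed in the classical topology, so Zariski density follows from
`mem_closure_general`. Applied to the origin, that lemma also shows that the surface is nonempty. -/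
lemma holdsAtGeneralPoint_of_isPolarPair {a : Fin 6 → ℂ} (ha : Function.Injective a)
    {P : ProjSpace 5 → Prop} (hP : ∀ (y : ProjSpace 5) (b c : ℂ), IsPolarPair a y.rep b c → P y) :
    HoldsAtGeneralPoint (kummerSurface a) P := by
  refine ⟨?_, degeneracyLocus a, isZariskiClosed_degeneracyLocus a, ?_, ?_⟩
  · have h0 : (0 : HomCoord 5) ∈ closure _ := mem_closure_general ha (x := 0) (by simp)
    obtain ⟨y, hy, hd⟩ := closure_nonempty_iff.1 ⟨_, h0⟩
    obtain ⟨h0, hmem⟩ := mk_mem_diff_degeneracyLocus hy hd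
    exact ⟨_, hmem.1⟩
  · rintro W ⟨S, hS, rfl⟩ hsub x hx F hF
    obtain ⟨d, hhom⟩ := hS F hF
    have hx' : ∀ k : Fin 3, ∑ i, a i ^ (k : ℕ) * x.rep i ^ 2 = 0 := fun k => by
      rw [← quadric_eq]; exact hx k
    have hcl : IsClosed {y : HomCoord 5 | MvPolynomial.eval y F = 0} :=
      isClosed_eq (MvPolynomial.continuous_eval F) continuous_const
    refine closure_minimal ?_ hcl (mem_closure_general ha hx')
    rintro y ⟨hy, hd⟩
    obtain ⟨h0, hmem⟩ := mk_mem_diff_degeneracyLocus hy hd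
    exact (eval_rep_mk_eq_zero_iff hhom h0).1 (hsub hmem F hF)
  · rintro y ⟨hy, hZ⟩
    have hd : MvPolynomial.eval y.rep (degeneracyPoly a) ≠ 0 := fun h0 =>
      hZ fun F hF => by rw [Set.mem_singleton_iff.1 hF, h0]
    rw [eval_degeneracyPoly] at hd
    obtain ⟨b, c, h⟩ := exists_isPolarPair ha (x := y.rep) (fun k => by rw [← quadric_eq]; exact hy k)
      (fun i => Finset.prod_ne_zero_iff.1 (left_ne_zero_of_mul (left_ne_zero_of_mul hd)) i
        (Finset.mem_univ i))
      (right_ne_zero_of_mul (left_ne_zero_of_mul hd)) (right_ne_zero_of_mul hd)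
    exact hP y b c h

/-- Two dense open sets meet: if they did not, the closed set excluded for `P` would contain all of
`X`, and the empty set would be dense in it. -/
lemma HoldsAtGeneralPoint.not_of_not {N : ℕ} {X : Set (ProjSpace N)} {P : ProjSpace N → Prop}
    (h : HoldsAtGeneralPoint X fun x => ¬ P x) : ¬ HoldsAtGeneralPoint X P := by
  rintro ⟨⟨x, hx⟩, Z, hZ, hZd, hP⟩
  obtain ⟨-, Z', hZ', hZd', hP'⟩ := h
  have h1 : X ⊆ Z := hZd' Z hZ fun y hy => by
    by_contra hyZ
    exact hP' y hy (hP y ⟨hy.1, hyZ⟩)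
  have hempty : IsZariskiClosed (∅ : Set (ProjSpace N)) :=
    ⟨{1}, fun F hF => ⟨0, hF ▸ MvPolynomial.isHomogeneous_one _ _⟩, by ext; simp⟩
  exact hZd ∅ hempty (fun y hy => hy.2 (h1 hy.1)) hx

lemma IsPolarPair.smul {a x : Fin 6 → ℂ} {b c : ℂ} (h : IsPolarPair a x b c) {s : ℂ} (hs : s ≠ 0) :
    IsPolarPair a (s • x) b c where
  coord_ne i := mul_ne_zero hs (h.coord_ne i)
  moment k := by
    simpa [mul_pow, mul_left_comm _ (s ^ 2), ← Finset.mul_sum, hs] using h.moment k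
  ne := h.ne
  left_ne := h.left_ne
  right_ne := h.right_ne
  left_zero := by
    simpa [mul_pow, mul_div_assoc, ← Finset.mul_sum, hs] using h.left_zero
  right_zero := by
    simpa [mul_pow, mul_div_assoc, ← Finset.mul_sum, hs] using h.right_zero

/-- An arbitrary parametrization starts at a nonzero multiple of the chosen representative, and
polar pairs are insensitive to scaling. -/
lemma IsPolarPair.holdsInLocalParametrizations {a : Fin 6 → ℂ} (ha : Function.Injective a)
    {y : ProjSpace 5} {b c : ℂ} (h : IsPolarPair a y.rep b c)
    {P : ((Fin 2 → ℂ) → HomCoord 5) → Prop}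
    (hP : ∀ φ, IsLocalParametrization (kummerSurface a) y φ → IsPolarPair a (φ 0) b c → P φ) :
    HoldsInLocalParametrizations (kummerSurface a) y P := by
  refine ⟨⟨_, h.isLocalParametrization_param ha y.submodule_eq⟩, fun φ hφ => hP φ hφ ?_⟩
  obtain ⟨s, hs, e⟩ := hφ.exists_base_eq
  rw [e]
  exact h.smul hs

end

theorem mainTheorem1 (a : Fin 6 → ℂ) (ha : Function.Injective a) :
    IsPhiSurface (kummerSurface a) ∧
    (¬ IsCoveredByLines (kummerSurface a) ∧
      HoldsAtGeneralPoint (kummerSurface a) fun y => ¬ LiesOnLineIn (kummerSurface a) y) ∧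
    HoldsAtGeneralPoint (kummerSurface a) fun y =>
      HoldsInLocalParametrizations (kummerSurface a) y fun φ =>
        ∃! σ : LinePencil y (tangentPlaneCone φ) → LinePencil y (tangentPlaneCone φ),
          IsInvolution σ ∧
          planeSections (kummerNet a) (tangentPlaneCone φ) = involutionPairs σ ∧
          hyperplaneSectionTangentCones φ = involutionPairs σ := by
  have hlines : HoldsAtGeneralPoint (kummerSurface a) fun y =>
      ¬ LiesOnLineIn (kummerSurface a) y :=
    holdsAtGeneralPoint_of_isPolarPair ha fun y b c h => h.not_liesOnLineIn ha y.submodule_eq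
  refine ⟨⟨le_rfl, ?_⟩, ⟨hlines.not_of_not, hlines⟩, ?_⟩
  · exact holdsAtGeneralPoint_of_isPolarPair ha fun y b c h =>
      h.holdsInLocalParametrizations ha fun φ hφ h' =>
        ⟨h'.finrank_osculatingCone_two ha hφ, h'.finrank_secondFundamentalSystem ha hφ⟩
  · exact holdsAtGeneralPoint_of_isPolarPair ha fun y b c h =>
      h.holdsInLocalParametrizations ha fun φ hφ h' => h'.existsUnique_involution ha hφ
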